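/- A finite simple graph $G$ is \emph{perfect} if $\chi(H)=\omega(H)$ for every induced subgraph $H$ of $G$, where $\chi(H)$ is the chromatic number of $H$ and $\omega(H)$ is the number of vertices of a largest clique of $H$. A \emph{pure pair} in $G$ is a pair $A,B$ of disjoint subsets of $V(G)$ such that either every vertex in $A$ is adjacent to every vertex in $B$, or no vertex in $A$ is adjacent to a vertex in $B$. Write $|G|$ for the number of vertices of $G$. For every real number $c>0$ there exists $\varepsilon>0$ such that every finite simple perfect graph $G$ with $|G|>1$ has a pure pair $A,B$ with $|A|\ge \varepsilon|G|$ and $|B|\ge \varepsilon|G|^{1-c}$. -/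

import Mathlib

universe u

namespace SimpleGraph

/-- A graph is perfect if the chromatic number of each of its induced subgraphs equals the
size of the largest clique of that subgraph. -/
def IsPerfect {V : Type u} (G : SimpleGraph V) : Prop :=
  ∀ s : Set V, (G.induce s).chromaticNumber = ((G.induce s).cliqueNum : ℕ∞)

/-- `A` is anticomplete to `B`: no vertex in `A` is adjacent to a vertex in `B`. -/
def IsAnticompleteBetween {V : Type u} (G : SimpleGraph V) (A B : Set V) : Prop :=
  ∀ ⦃a⦄, a ∈ A → ∀ ⦃b⦄, b ∈ B → ¬ G.Adj a b

/-- A pure pair: disjoint sets of vertices, complete or anticomplete to each other. -/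
def IsPurePair {V : Type u} (G : SimpleGraph V) (A B : Finset V) : Prop :=
  Disjoint A B ∧ (G.IsCompleteBetween (A : Set V) (B : Set V) ∨
    G.IsAnticompleteBetween (A : Set V) (B : Set V))

end SimpleGraph

/-!
Counting colour classes gives `|H| ≤ ω(H) α(H)` for every induced subgraph `H` of a perfect graph,
and odd holes and antiholes violate this, so perfect graphs are Berge. By Rödl's theorem a graph
without induced `C₅` has a set of linear size in which the graph or its complement is sparse. It
remains to find an odd hole in a sparse graph in which any `εn ^ (1 - c)` vertices have neighbours
among all but few of the others; here few means `O(εn)`.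

Let `T` and `K` be connected, with no edges between them and with a common attached vertex `a`.
Joining `x`, attached to `T`, and `b`, attached to `K`, by an edge or by an induced path of length
two closes the induced paths from `a` to `x` and from `a` to `b` to a hole, so the parities of these
paths tell which of the two can occur: for large classes of tips `x` and `b` every path of length
two is part of a triangle. Three connected sets, far apart, with large sets of tips contradict this
for two of the three pairs. To grow such sets one uses balls: in a suitable subset their
sizes jump at some radius, and the number of ball vertices needed to cover a given number of
vertices, measured on the scale of powers of `t = n ^ (c / 2)`, does not change when few vertices
are deleted. Both are found by pigeonhole, as there are only boundedly many scales below `n`. Part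
of a new ball then covers the required number of vertices and consists of at most `t` chunks, each
too small to cover many tips of an older set. One chunk covers many vertices outside, and the edges
from these to the tips it misses lie in no triangle through the chunk; so the parities do not force
triangles there, and the new set can be chosen without edges to many of the old tips.
-/

namespace PurePairs

open SimpleGraph Finset
open scoped SimpleGraph

section Berge

variable {V : Type u} {G : SimpleGraph V}

/-- A graph without odd hole: no induced cycle of odd length at least five. -/
def OddHoleFree (G : SimpleGraph V) : Prop :=
  ∀ k, 2 ≤ k → ¬ cycleGraph (2 * k + 1) ⊴ G

/-- A Berge graph: neither the graph nor its complement contains an odd hole. -/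
def IsBerge (G : SimpleGraph V) : Prop :=
  OddHoleFree G ∧ OddHoleFree Gᶜ

theorem card_le_mul_indepNum_of_colorable [Fintype V] {n : ℕ} (h : G.Colorable n) :
    Fintype.card V ≤ n * G.indepNum := by
  classical
  obtain ⟨C⟩ := h
  have card_fibre (i : Fin n) : #{v | C v = i} ≤ G.indepNum := by
    refine IsIndepSet.card_le_indepNum fun x hx y hy _ hxy => C.valid hxy ?_
    simp only [coe_filter, mem_univ, true_and, Set.mem_ofPred_eq] at hx hy
    exact hx.trans hy.symm
  calc Fintype.card V ≤ G.indepNum * #(univ.image C) :=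
        card_le_mul_card_image _ _ fun i _ => card_fibre i
    _ ≤ G.indepNum * n := by gcongr; simpa using card_le_univ (univ.image C)
    _ = n * G.indepNum := mul_comm _ _

theorem card_le_cliqueNum_mul_indepNum_of_isIndContained {W : Type*} [Fintype W]
    {H : SimpleGraph W} (hG : G.IsPerfect) (hH : H ⊴ G) :
    Fintype.card W ≤ H.cliqueNum * H.indepNum := by
  obtain ⟨s, ⟨e⟩⟩ := isIndContained_iff_exists_iso_induce.1 hH
  have : Finite s := .of_equiv W e.toEquiv
  have cliqueNum_le : (G.induce s).cliqueNum ≤ H.cliqueNum := by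
    obtain ⟨K, hK⟩ := (G.induce s).exists_isNClique_cliqueNum
    rw [← hK.card_eq, ← card_map e.symm.toEquiv.toEmbedding]
    refine IsClique.card_le_cliqueNum (tc := ?_)
    rw [coe_map]
    rintro _ ⟨x, hx, rfl⟩ _ ⟨y, hy, rfl⟩ hxy
    exact e.symm.map_adj_iff.2 (hK.isClique hx hy fun h => hxy (congrArg _ h))
  have colorable : H.Colorable (G.induce s).cliqueNum :=
    (chromaticNumber_le_iff_colorable.1 (hG s).le).of_hom e.toHom
  exact (card_le_mul_indepNum_of_colorable colorable).trans (by gcongr)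

theorem cycleGraph_adj_iff_of_lt {n : ℕ} {i j : Fin n} (hij : i < j) :
    (cycleGraph n).Adj i j ↔ (j : ℕ) = i + 1 ∨ (i : ℕ) = 0 ∧ (j : ℕ) + 1 = n := by
  have := Fin.lt_def.1 hij
  rw [cycleGraph_adj', Fin.coe_sub_iff_le.2 hij.le, Fin.coe_sub_iff_lt.2 hij]
  omega

theorem cliqueNum_cycleGraph_le_two {n : ℕ} (hn : 4 ≤ n) : (cycleGraph n).cliqueNum ≤ 2 := by
  obtain ⟨K, hK⟩ := (cycleGraph n).exists_isNClique_cliqueNum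
  rw [← hK.card_eq]
  by_contra! hcard
  obtain ⟨a, b, c, ha, hb, hc, hab, hac, hbc⟩ := two_lt_card_iff.1 hcard
  have adj : ∀ i ∈ K, ∀ j ∈ K, (i : ℕ) < j → (j : ℕ) = i + 1 ∨ (i : ℕ) = 0 ∧ (j : ℕ) + 1 = n :=
    fun i hi j hj hij => (cycleGraph_adj_iff_of_lt hij).1 (hK.isClique hi hj (Fin.ne_of_lt hij))
  have := adj a ha b hb
  have := adj b hb a ha
  have := adj a ha c hc
  have := adj c hc a ha
  have := adj b hb c hc
  have := adj c hc b hb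
  omega

theorem two_mul_indepNum_cycleGraph_le (n : ℕ) : 2 * (cycleGraph (n + 2)).indepNum ≤ n + 2 := by
  obtain ⟨I, hI⟩ := (cycleGraph (n + 2)).exists_isNIndepSet_indepNum
  have disjoint_succ : Disjoint I (I.map (Equiv.addRight 1).toEmbedding) := by
    simp only [Finset.disjoint_left, mem_map_equiv, Equiv.addRight_symm_apply]
    intro i hi hj
    have adj : (cycleGraph (n + 2)).Adj i (i + -1) := cycleGraph_adj.2 (by simp)
    exact hI.isIndepSet hi hj adj.ne adj
  have := card_le_univ (I.disjUnion _ disjoint_succ)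
  rw [card_disjUnion, card_map, hI.card_eq, Fintype.card_fin] at this
  omega

theorem cliqueNum_mul_indepNum_cycleGraph_lt {k : ℕ} (hk : 2 ≤ k) :
    (cycleGraph (2 * k + 1)).cliqueNum * (cycleGraph (2 * k + 1)).indepNum < 2 * k + 1 := by
  obtain ⟨n, rfl⟩ := Nat.exists_eq_add_of_le hk
  have clique := cliqueNum_cycleGraph_le_two (n := 2 * (2 + n) + 1) (by omega)
  have indep := two_mul_indepNum_cycleGraph_le (2 * n + 3)
  rw [show 2 * n + 3 + 2 = 2 * (2 + n) + 1 by ring] at indep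
  calc _ ≤ 2 * (cycleGraph (2 * (2 + n) + 1)).indepNum := by gcongr
    _ < 2 * (2 + n) + 1 := by omega

theorem isBerge_of_isPerfect (hG : G.IsPerfect) : IsBerge G := by
  refine ⟨fun k hk hole => ?_, fun k hk antihole => ?_⟩
  · have := card_le_cliqueNum_mul_indepNum_of_isIndContained hG hole
    rw [Fintype.card_fin] at this
    exact (cliqueNum_mul_indepNum_cycleGraph_lt hk).not_ge this
  · have hcompl : (cycleGraph (2 * k + 1))ᶜ ⊴ G := by
      rwa [← compl_isIndContained_compl, compl_compl]
    have := card_le_cliqueNum_mul_indepNum_of_isIndContained hG hcompl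
    rw [Fintype.card_fin, cliqueNum_compl, indepNum_compl,
      mul_comm (indepNum _)] at this
    exact (cliqueNum_mul_indepNum_cycleGraph_lt hk).not_ge this

end Berge

open scoped Classical

section InducedPaths

variable {V : Type u} {G : SimpleGraph V} {S T K : Finset V} {a b x y : V} {k l : ℕ} {p r : ℕ → V}

/-- `x` is attached to `T`: it lies outside `T` and has a neighbour in `T`. -/
def IsAttached (G : SimpleGraph V) (T : Finset V) (x : V) : Prop :=
  x ∉ T ∧ ∃ t ∈ T, G.Adj t x

/-- `x` is detached from `T`: it lies outside `T` and has no neighbour in `T`. -/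
def IsDetached (G : SimpleGraph V) (T : Finset V) (x : V) : Prop :=
  x ∉ T ∧ ∀ t ∈ T, ¬ G.Adj t x

/-- Two disjoint sets of vertices with no edge between them. -/
def IsSeparated (G : SimpleGraph V) (T K : Finset V) : Prop :=
  ∀ t ∈ T, IsDetached G K t

theorem IsDetached.mono (h : S ⊆ T) (hx : IsDetached G T x) : IsDetached G S x :=
  ⟨fun hS => hx.1 (h hS), fun t ht => hx.2 t (h ht)⟩

theorem IsDetached.ne (hx : IsDetached G T x) (ha : a ∈ T) : a ≠ x :=
  fun h => hx.1 (h ▸ ha)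

theorem isDetached_insert :
    IsDetached G (insert a T) x ↔ (a ≠ x ∧ ¬ G.Adj a x) ∧ IsDetached G T x := by
  simp only [IsDetached, mem_insert, forall_eq_or_imp, eq_comm (a := x), not_or]
  tauto

theorem isDetached_union : IsDetached G (S ∪ T) x ↔ IsDetached G S x ∧ IsDetached G T x := by
  simp only [IsDetached, mem_union, or_imp, forall_and, not_or]
  tauto

theorem IsSeparated.symm (h : IsSeparated G T K) : IsSeparated G K T :=
  fun k hk => ⟨fun hT => (h k hT).1 hk, fun t ht hadj => (h t ht).2 k hk hadj.symm⟩

theorem IsSeparated.insert_right (h : IsSeparated G T K) (hb : IsDetached G T b) :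
    IsSeparated G T (insert b K) :=
  fun t ht => isDetached_insert.2 ⟨⟨(hb.ne ht).symm, fun hadj => hb.2 t ht hadj.symm⟩, h t ht⟩

/-- The sequence `p 0, …, p l` is an induced path from `a` to `x` whose interior lies in `T`. -/
structure IsInducedPathVia (G : SimpleGraph V) (T : Finset V) (a x : V) (l : ℕ) (p : ℕ → V) :
    Prop where
  start : p 0 = a
  finish : p l = x
  interior : ∀ i, 0 < i → i < l → p i ∈ T
  induced : ∀ i j, i < j → j ≤ l → p i ≠ p j ∧ (G.Adj (p i) (p j) ↔ j = i + 1)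

theorem IsInducedPathVia.length_pos (hp : IsInducedPathVia G T a x l p) (hax : a ≠ x) : 0 < l :=
  Nat.pos_of_ne_zero fun h => hax (by rw [← hp.start, ← hp.finish, h])

theorem IsInducedPathVia.two_le_length (hp : IsInducedPathVia G T a x l p) (hax : a ≠ x)
    (hadj : ¬ G.Adj a x) : 2 ≤ l := by
  have hl := hp.length_pos hax
  have := (hp.induced 0 l hl le_rfl).2
  rw [hp.start, hp.finish] at this
  have := mt this.2 hadj
  omega

theorem IsInducedPathVia.ne_and_not_adj (hp : IsInducedPathVia G T a x l p)
    (hy : IsDetached G (insert a T) y) {i : ℕ} (hi : i < l) : p i ≠ y ∧ ¬ G.Adj (p i) y := by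
  have hmem : p i ∈ insert a T := by
    rcases i.eq_zero_or_pos with rfl | hpos
    · simp [hp.start]
    · exact mem_insert_of_mem (hp.interior i hpos hi)
  exact ⟨hy.ne hmem, hy.2 _ hmem⟩

theorem IsInducedPathVia.snoc (hp : IsInducedPathVia G T a x l p)
    (hy : IsDetached G (insert a T) y) (hxy : G.Adj x y) :
    IsInducedPathVia G (insert x T) a y (l + 1) (Function.update p (l + 1) y) := by
  have update_of_le {i : ℕ} (hi : i ≤ l) : Function.update p (l + 1) y i = p i :=
    Function.update_of_ne (by omega) _ _
  refine ⟨by rw [update_of_le l.zero_le, hp.start], Function.update_self .., ?_, ?_⟩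
  · intro i hi hil
    rw [update_of_le (by omega)]
    rcases (Nat.lt_succ_iff.1 hil).lt_or_eq with h | rfl
    · exact mem_insert_of_mem (hp.interior i hi h)
    · simp [hp.finish]
  · intro i j hij hj
    rw [update_of_le (i := i) (by omega)]
    rcases hj.lt_or_eq with h | rfl
    · rw [update_of_le (by omega)]
      exact hp.induced i j hij (by omega)
    rw [Function.update_self]
    rcases (Nat.lt_succ_iff.1 hij).lt_or_eq with h | rfl
    · obtain ⟨ne, not_adj⟩ := hp.ne_and_not_adj hy h
      exact ⟨ne, iff_of_false not_adj (by omega)⟩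
    · rw [hp.finish]
      exact ⟨hxy.ne, iff_of_true hxy rfl⟩

theorem getVert_adj_iff_of_length_eq_dist {w : G.Walk a x} (hw : w.length = G.dist a x) {i j : ℕ}
    (hij : i < j) (hj : j ≤ w.length) : G.Adj (w.getVert i) (w.getVert j) ↔ j = i + 1 := by
  refine ⟨fun hadj => ?_, ?_⟩
  · have shortcut := dist_le ((w.take i).append (.cons hadj (w.drop j)))
    rw [Walk.length_append, Walk.length_cons, Walk.take_length, Walk.drop_length] at shortcut
    omega
  · rintro rfl
    exact w.adj_getVert_succ hj

theorem exists_isInducedPathVia (hT : (G.induce (T : Set V)).Connected) (ha : IsAttached G T a)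
    (hx : IsAttached G T x) : ∃ l p, IsInducedPathVia G T a x l p := by
  have adjoin {U : Set V} {c : V} (hTU : (T : Set V) ⊆ U) (hU : (G.induce U).Connected)
      (hc : IsAttached G T c) : (G.induce (U ∪ {c})).Connected := by
    obtain ⟨-, t, ht, htc⟩ := hc
    exact connected_induce_union hU.preconnected .of_subsingleton (hTU ht) rfl htc
  have connected := adjoin Set.subset_union_left (adjoin subset_rfl hT ha) hx
  set U : Set V := (T : Set V) ∪ {a} ∪ {x}
  obtain ⟨w, hw⟩ := connected.exists_walk_length_eq_dist ⟨a, by simp [U]⟩ ⟨x, by simp [U]⟩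
  have injOn := (w.isPath_of_length_eq_dist hw).getVert_injOn
  have ne {i j : ℕ} (hi : i ≤ w.length) (hj : j ≤ w.length) (hij : i ≠ j) :
      (w.getVert i : V) ≠ w.getVert j :=
    fun h => hij (injOn hi hj (Subtype.ext h))
  refine ⟨w.length, fun i => w.getVert i, by simp, by simp, fun i hi hil => ?_,
    fun i j hij hj => ⟨ne (by omega) hj hij.ne, getVert_adj_iff_of_length_eq_dist hw hij hj⟩⟩
  have ne_start := ne hil.le (Nat.zero_le _) hi.ne'
  have ne_finish := ne hil.le le_rfl hil.ne
  rw [Walk.getVert_zero] at ne_start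
  rw [Walk.getVert_length] at ne_finish
  exact ((w.getVert i).2.resolve_right ne_finish).resolve_right ne_start

theorem cycleGraph_isIndContained {n : ℕ} {h : ℕ → V}
    (hh : ∀ i j, i < j → j < n →
      h i ≠ h j ∧ (G.Adj (h i) (h j) ↔ j = i + 1 ∨ i = 0 ∧ j + 1 = n)) :
    cycleGraph n ⊴ G := by
  have injective : Function.Injective fun i : Fin n => h i := by
    intro i j hij
    by_contra hne
    rcases lt_or_gt_of_ne hne with hlt | hlt
    · exact (hh i j hlt j.2).1 hij
    · exact (hh j i hlt i.2).1 hij.symm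
  refine ⟨⟨⟨fun i => h i, injective⟩, @fun i j => ?_⟩⟩
  change G.Adj (h i) (h j) ↔ _
  rcases lt_trichotomy i j with hlt | rfl | hlt
  · rw [(hh i j hlt j.2).2, cycleGraph_adj_iff_of_lt hlt]
  · simp
  · rw [G.adj_comm, (hh j i hlt i.2).2, (cycleGraph n).adj_comm, cycleGraph_adj_iff_of_lt hlt]

theorem cycleGraph_isIndContained_of_isInducedPathVia (hTK : IsSeparated G T K)
    (hp : IsInducedPathVia G T a x k p) (hr : IsInducedPathVia G K a b l r)
    (hx : IsDetached G K x) (hb : IsDetached G T b) (hxb : G.Adj x b) (hl : 0 < l) (hk : 2 ≤ k) :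
    cycleGraph (k + l + 1) ⊴ G := by
  have cross {i j : ℕ} (hi : 0 < i) (hik : i ≤ k) (hj : 0 < j) (hjl : j ≤ l) :
      p i ≠ r j ∧ (G.Adj (p i) (r j) ↔ i = k ∧ j = l) := by
    rcases hik.lt_or_eq with hik | rfl <;> rcases hjl.lt_or_eq with hjl | rfl
    · have sep := hTK _ (hp.interior i hi hik)
      have mem := hr.interior j hj hjl
      exact ⟨(sep.ne mem).symm, iff_of_false (fun h => sep.2 _ mem h.symm) (by omega)⟩
    · have mem := hp.interior i hi hik
      rw [hr.finish]
      exact ⟨hb.ne mem, iff_of_false (hb.2 _ mem) (by omega)⟩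
    · have mem := hr.interior j hj hjl
      rw [hp.finish]
      exact ⟨(hx.ne mem).symm, iff_of_false (fun h => hx.2 _ mem h.symm) (by omega)⟩
    · rw [hp.finish, hr.finish]
      exact ⟨hxb.ne, iff_of_true hxb ⟨rfl, rfl⟩⟩
  refine cycleGraph_isIndContained (h := fun i => if i ≤ k then p i else r (k + l + 1 - i)) ?_
  intro i j hij hj
  by_cases hjk : j ≤ k
  · obtain ⟨ne, adj_iff⟩ := hp.induced i j hij hjk
    simp only [hjk, hij.le.trans hjk, if_true]
    exact ⟨ne, adj_iff.trans (by omega)⟩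
  by_cases hik : i ≤ k
  · simp only [hjk, hik, if_true, if_false]
    rcases i.eq_zero_or_pos with rfl | hi
    · obtain ⟨ne, adj_iff⟩ := hr.induced 0 (k + l + 1 - j) (by omega) (by omega)
      rw [hp.start, ← hr.start]
      exact ⟨ne, adj_iff.trans (by omega)⟩
    · obtain ⟨ne, adj_iff⟩ := cross hi hik (j := k + l + 1 - j) (by omega) (by omega)
      exact ⟨ne, adj_iff.trans (by omega)⟩
  · obtain ⟨ne, adj_iff⟩ := hr.induced (k + l + 1 - j) (k + l + 1 - i) (by omega) (by omega)
    simp only [hjk, hik, if_false]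
    exact ⟨ne.symm, (G.adj_comm _ _).trans (adj_iff.trans (by omega))⟩

theorem odd_add_of_isInducedPathVia (hG : OddHoleFree G) (hTK : IsSeparated G T K)
    (hp : IsInducedPathVia G T a x k p) (hr : IsInducedPathVia G K a b l r)
    (hx : IsDetached G (insert a K) x) (hb : IsDetached G T b) (hxb : G.Adj x b) (hab : a ≠ b) :
    Odd (k + l) := by
  obtain ⟨⟨hax, hax'⟩, hxK⟩ := isDetached_insert.1 hx
  have hk := hp.two_le_length hax hax'
  have hl := hr.length_pos hab
  have hole := cycleGraph_isIndContained_of_isInducedPathVia hTK hp hr hxK hb hxb hl hk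
  by_contra hodd
  obtain ⟨m, hm⟩ := Nat.not_odd_iff_even.1 hodd
  exact hG m (by omega) (by rwa [two_mul, ← hm])

theorem exists_parity_colouring (hG : OddHoleFree G) (hT : (G.induce (T : Set V)).Connected)
    (hK : (G.induce (K : Set V)).Connected) (hTK : IsSeparated G T K)
    (haT : IsAttached G T a) (haK : IsAttached G K a) :
    ∃ f g : V → Bool, ∀ x b, IsAttached G T x → IsDetached G (insert a K) x →
      IsAttached G K b → IsDetached G T b → a ≠ b →
      (G.Adj x b → f x ≠ g b) ∧
      ∀ y, IsDetached G T y → IsDetached G (insert a K) y →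
        G.Adj x y → G.Adj y b → ¬ G.Adj x b → f x = g b := by
  choose! f p hp using fun x => exists_isInducedPathVia (x := x) hT haT
  choose! g r hr using fun b => exists_isInducedPathVia (x := b) hK haK
  refine ⟨fun x => decide (Even (f x)), fun b => decide (Even (g b)), ?_⟩
  intro x b hxT hxK hbK hbT hab
  refine ⟨fun hxb => ?_, fun y hyT hyK hxy hyb hxb => ?_⟩
  · have odd := odd_add_of_isInducedPathVia hG hTK (hp x hxT) (hr b hbK) hxK hbT hxb hab
    rw [Nat.odd_add, ← Nat.not_even_iff_odd] at odd
    simp only [ne_eq, decide_eq_decide]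
    tauto
  · have hxb_ne : b ≠ x := by
      rintro rfl
      obtain ⟨t, ht, htb⟩ := hxT.2
      exact hbT.2 t ht htb
    have hx : IsDetached G (insert a (insert b K)) x := by
      rw [insert_comm]
      exact isDetached_insert.2 ⟨⟨hxb_ne, fun h => hxb h.symm⟩, hxK⟩
    have odd := odd_add_of_isInducedPathVia hG (hTK.insert_right hbT) (hp x hxT)
      ((hr b hbK).snoc hyK hyb.symm) hx hyT hxy (isDetached_insert.1 hyK).1.1
    rw [← add_assoc, Nat.odd_add_one, Nat.not_odd_iff_even, Nat.even_add] at odd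
    simpa only [decide_eq_decide] using odd

end InducedPaths

section Coherent

variable {V : Type u} {G : SimpleGraph V} {d m : ℕ} {B B' K S S' : Finset V} {v : V}

/-- The members of `S` that have a neighbour in `B`: the part of `S` covered by `B`. -/
noncomputable def nbrs (G : SimpleGraph V) (B S : Finset V) : Finset V :=
  {v ∈ S | ∃ b ∈ B, G.Adj b v}

/-- The members of `S` that are detached from `K`. -/
noncomputable def far (G : SimpleGraph V) (K S : Finset V) : Finset V :=
  {v ∈ S | IsDetached G K v}

theorem mem_nbrs : v ∈ nbrs G B S ↔ v ∈ S ∧ ∃ b ∈ B, G.Adj b v :=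
  mem_filter

theorem mem_far : v ∈ far G K S ↔ v ∈ S ∧ IsDetached G K v :=
  mem_filter

theorem nbrs_empty : nbrs G ∅ S = ∅ := by
  simp [nbrs]

theorem nbrs_subset : nbrs G B S ⊆ S :=
  filter_subset _ _

theorem far_subset : far G K S ⊆ S :=
  filter_subset _ _

theorem nbrs_mono (hB : B ⊆ B') (hS : S ⊆ S') : nbrs G B S ⊆ nbrs G B' S' := by
  intro v hv
  obtain ⟨hvS, b, hb, hadj⟩ := mem_nbrs.1 hv
  exact mem_nbrs.2 ⟨hS hvS, b, hB hb, hadj⟩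

theorem nbrs_union : nbrs G (B ∪ B') S = nbrs G B S ∪ nbrs G B' S := by
  ext v
  simp only [mem_nbrs, mem_union, or_and_right, exists_or, and_or_left]

theorem card_nbrs_union_le : #(nbrs G (B ∪ B') S) ≤ #(nbrs G B S) + #(nbrs G B' S) :=
  nbrs_union (G := G) ▸ card_union_le _ _

theorem card_le_card_far_add : #S ≤ #(far G K S) + #(nbrs G K S) + #(S ∩ K) := by
  have cover : S ⊆ far G K S ∪ nbrs G K S ∪ S ∩ K := by
    intro v hv
    simp only [mem_union, mem_far, mem_nbrs, mem_inter, IsDetached, hv, true_and]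
    by_cases hadj : ∃ k ∈ K, G.Adj k v
    · exact .inl (.inr hadj)
    · push Not at hadj
      tauto
  have := card_le_card cover
  have := card_union_le (far G K S ∪ nbrs G K S) (S ∩ K)
  have := card_union_le (far G K S) (nbrs G K S)
  omega

theorem exists_card_le_two_mul_card_filter (C : Finset V) (f : V → Bool) :
    ∃ e, #C ≤ 2 * #{x ∈ C | f x = e} := by
  have split := card_filter_add_card_filter_not (s := C) (fun x => f x = true)
  simp only [Bool.not_eq_true] at split
  by_cases h : #C ≤ 2 * #{x ∈ C | f x = true}
  · exact ⟨true, h⟩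
  · exact ⟨false, by omega⟩

theorem exists_card_nbrs_le_two_mul_card_nbrs_filter (B W : Finset V) (g : V → Bool) :
    ∃ e, #(nbrs G B W) ≤ 2 * #(nbrs G {x ∈ B | g x = e} W) := by
  have split := card_nbrs_union_le (G := G) (B := {x ∈ B | g x = true})
    (B' := {x ∈ B | ¬ g x = true}) (S := W)
  rw [filter_union_filter_not_eq] at split
  simp only [Bool.not_eq_true] at split
  by_cases h : #(nbrs G B W) ≤ 2 * #(nbrs G {x ∈ B | g x = true} W)
  · exact ⟨true, h⟩
  · exact ⟨false, by omega⟩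

theorem exists_subset_card_le_card_nbrs_le_mul (W : Finset V) (s q : ℕ) (hB : #B ≤ q * s) :
    ∃ P ⊆ B, #P ≤ s ∧ #(nbrs G B W) ≤ q * #(nbrs G P W) := by
  induction q generalizing B with
  | zero => exact ⟨∅, empty_subset B, by simp, by simp_all [nbrs_empty]⟩
  | succ q ih =>
    obtain ⟨P, hPB, hP⟩ := exists_subset_card_eq (min_le_right s #B)
    have hrest : #(B \ P) ≤ q * s := by
      rw [card_sdiff_of_subset hPB, hP]
      rw [add_mul, one_mul] at hB
      omega
    obtain ⟨P', hP'B, hP', hcover⟩ := ih hrest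
    have split := card_nbrs_union_le (G := G) (B := P) (B' := B \ P) (S := W)
    rw [union_sdiff_of_subset hPB] at split
    rcases le_total #(nbrs G P W) #(nbrs G P' W) with hle | hle
    · exact ⟨P', hP'B.trans sdiff_subset, hP', by rw [add_mul, one_mul]; omega⟩
    · have := Nat.mul_le_mul_left q hle
      exact ⟨P, hPB, by omega, by rw [add_mul, one_mul]; omega⟩

/-- The sparse graphs without large anticomplete pair in which odd holes are to be found: all
degrees are at most `d`, and any two disjoint sets of sizes at least `d` and `m`, where
`1 ≤ m ≤ d`, are joined by an edge. -/
structure IsCoherent (G : SimpleGraph V) (d m : ℕ) : Prop where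
  card_nbrs_singleton : ∀ v S, #(nbrs G {v} S) ≤ d
  exists_adj : ∀ ⦃A B⦄, Disjoint A B → d ≤ #A → m ≤ #B → ∃ a ∈ A, ∃ b ∈ B, G.Adj a b
  one_le : 1 ≤ m
  le : m ≤ d

theorem IsCoherent.card_le_card_nbrs_add (hG : IsCoherent G d m) (hB : m ≤ #B) :
    #S ≤ #(nbrs G B S) + 2 * d := by
  obtain ⟨B', hB'B, hB'⟩ := exists_subset_card_eq hB
  have uncovered : #((S \ nbrs G B S) \ B') < d := by
    by_contra! hlarge
    obtain ⟨a, ha, b, hb, hadj⟩ := hG.exists_adj sdiff_disjoint hlarge hB'.ge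
    obtain ⟨haS, ha⟩ := mem_sdiff.1 (mem_sdiff.1 ha).1
    exact ha (mem_nbrs.2 ⟨haS, b, hB'B hb, hadj.symm⟩)
  have := le_card_sdiff B' (S \ nbrs G B S)
  have := le_card_sdiff (nbrs G B S) S
  have := hG.le
  omega

theorem IsCoherent.card_nbrs_insert_le (hG : IsCoherent G d m) (b : V) (B S : Finset V) :
    #(nbrs G (insert b B) S) ≤ #(nbrs G B S) + d := by
  have := card_nbrs_union_le (G := G) (B := {b}) (B' := B) (S := S)
  have := hG.card_nbrs_singleton b S
  rw [insert_eq]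
  omega

theorem IsCoherent.card_nbrs_le_mul (hG : IsCoherent G d m) (B S : Finset V) :
    #(nbrs G B S) ≤ #B * d := by
  induction B using Finset.induction_on with
  | empty => simp [nbrs_empty]
  | insert b B hb ih =>
    rw [card_insert_of_notMem hb, add_mul, one_mul]
    exact (hG.card_nbrs_insert_le b B S).trans (by gcongr)

theorem IsCoherent.exists_subset_card_nbrs_le (hG : IsCoherent G d m) {L : ℕ}
    (hL : L ≤ #(nbrs G B S)) : ∃ B' ⊆ B, L ≤ #(nbrs G B' S) ∧ #(nbrs G B' S) ≤ L + d := by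
  induction B using Finset.induction_on with
  | empty => exact ⟨∅, subset_rfl, hL, by simp [nbrs_empty]⟩
  | insert b B _ ih =>
    by_cases hB : L ≤ #(nbrs G B S)
    · obtain ⟨B', hB'B, hB'⟩ := ih hB
      exact ⟨B', hB'B.trans (subset_insert _ _), hB'⟩
    · have := hG.card_nbrs_insert_le b B S
      exact ⟨insert b B, subset_rfl, hL, by omega⟩

end Coherent

section Arms

variable {V : Type u} {G : SimpleGraph V} {d m s t κ L : ℕ}
  {B C C₁ C₂ C₃ D E K S S' T T₁ T₂ T₃ U W X : Finset V} {a u x : V}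

theorem IsAttached.not_isDetached (hx : IsAttached G T x) : ¬ IsDetached G T x :=
  fun h => let ⟨t, ht, hadj⟩ := hx.2; h.2 t ht hadj

theorem IsSeparated.mono (h : IsSeparated G T K) (hS : S ⊆ T) (hS' : S' ⊆ K) :
    IsSeparated G S S' :=
  fun t ht => (h t (hS ht)).mono hS'

theorem IsSeparated.far_eq (h : IsSeparated G S K) : far G K S = S :=
  filter_true_of_mem h

theorem isSeparated_far : IsSeparated G (far G K S) K :=
  fun _ h => (mem_far.1 h).2

theorem isSeparated_union_right :
    IsSeparated G S (T ∪ K) ↔ IsSeparated G S T ∧ IsSeparated G S K := by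
  simp only [IsSeparated, isDetached_union, forall_and]

/-- A connected set `T` together with a set `C` of tips attached to it. -/
structure IsArm (G : SimpleGraph V) (T C : Finset V) : Prop where
  connected : (G.induce (T : Set V)).Connected
  isAttached : ∀ c ∈ C, IsAttached G T c

theorem IsArm.mono (h : IsArm G T C) (hD : D ⊆ C) : IsArm G T D :=
  ⟨h.connected, fun c hc => h.isAttached c (hD hc)⟩

theorem IsArm.disjoint (h : IsArm G T C) (hW : IsSeparated G W T) : Disjoint C W :=
  Finset.disjoint_left.2 fun c hc hcW => (h.isAttached c hc).not_isDetached (hW c hcW)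

theorem IsArm.connected_insert (h : IsArm G T C) (ha : a ∈ C) :
    (G.induce ((insert a T : Finset V) : Set V)).Connected := by
  obtain ⟨t, ht, hta⟩ := (h.isAttached a ha).2
  rw [coe_insert, ← Set.union_singleton]
  exact connected_induce_union h.connected.preconnected .of_subsingleton ht rfl hta

theorem IsArm.insert_tip (h : IsArm G T C) (ha : a ∈ C) : IsArm G (insert a T) (C.erase a) := by
  refine ⟨h.connected_insert ha, fun c hc => ?_⟩
  obtain ⟨hca, hcC⟩ := mem_erase.1 hc
  obtain ⟨hcT, t, ht, htc⟩ := h.isAttached c hcC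
  exact ⟨by simp [hca, hcT], t, mem_insert_of_mem ht, htc⟩

theorem IsArm.insert_sdiff (h : IsArm G T (C \ T)) (ha : a ∈ T ∪ C) :
    IsArm G (insert a T) (C \ insert a T) := by
  by_cases haT : a ∈ T
  · rwa [insert_eq_of_mem haT]
  · rw [sdiff_insert]
    exact h.insert_tip (by simp_all)

theorem IsArm.connected_union (h : IsArm G T C) :
    (G.induce ((T ∪ C : Finset V) : Set V)).Connected := by
  induction C using Finset.induction_on generalizing T with
  | empty => rw [union_empty]; exact h.connected
  | insert c C hc ih =>
    have := ih (by simpa [hc] using h.insert_tip (mem_insert_self c C))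
    rwa [insert_union, ← union_insert] at this

/-- Every path of length two from `C` through `W` to `D` spans a triangle. -/
def ClosesTriangles (G : SimpleGraph V) (C W D : Finset V) : Prop :=
  ∀ x ∈ C, ∀ w ∈ W, ∀ b ∈ D, G.Adj x w → G.Adj w b → G.Adj x b

/- Equality of colours is forced by an induced path of length two and excluded by an edge, so two
colour classes joined by an edge close all triangles. -/
theorem exists_colouring_closesTriangles (hG : OddHoleFree G) (hT : IsArm G T C)
    (hK : IsArm G K D) (hTK : IsSeparated G T K) (haT : IsAttached G T a)
    (haK : IsAttached G K a) (hC : IsSeparated G C (insert a K)) (hD : IsSeparated G D T)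
    (ha : a ∉ D) :
    ∃ f g : V → Bool, ∀ e e', (∃ x ∈ {x ∈ C | f x = e}, ∃ b ∈ {b ∈ D | g b = e'}, G.Adj x b) →
      ∀ W, IsSeparated G W (insert a (T ∪ K)) →
        ClosesTriangles G {x ∈ C | f x = e} W {b ∈ D | g b = e'} := by
  obtain ⟨f, g, hfg⟩ := exists_parity_colouring hG hT.connected hK.connected hTK haT haK
  refine ⟨f, g, ?_⟩
  simp only [mem_filter]
  rintro e e' ⟨x', ⟨hx', rfl⟩, b', ⟨hb', rfl⟩, hadj⟩ W hW x hx w hw b hb hxw hwb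
  simp only [mem_filter] at hx hb
  have differ := (hfg x' b' (hT.isAttached x' hx') (hC x' hx') (hK.isAttached b' hb')
    (hD b' hb') fun h => ha (h ▸ hb')).1 hadj
  by_contra hxb
  have agree := (hfg x b (hT.isAttached x hx.1) (hC x hx.1) (hK.isAttached b hb.1)
    (hD b hb.1) fun h => ha (h ▸ hb.1)).2 w ((hW w hw).mono (by grind))
    ((hW w hw).mono (by grind)) hxw hwb hxb
  exact differ (by rw [← hx.2, ← hb.2, agree])

theorem IsCoherent.one_le_degree_bound (hG : IsCoherent G d m) : 1 ≤ d :=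
  hG.one_le.trans hG.le

theorem IsCoherent.card_far_le_card_far_insert (hG : IsCoherent G d m) (a : V) (K S : Finset V) :
    #(far G K S) ≤ #(far G (insert a K) S) + 2 * d := by
  have cover : far G K S ⊆ far G (insert a K) S ∪ insert a (nbrs G {a} S) := by
    intro v hv
    simp only [mem_union, mem_insert, mem_far, mem_nbrs, mem_singleton, exists_eq_left,
      isDetached_insert] at hv ⊢
    tauto
  have := card_le_card cover
  have := card_union_le (far G (insert a K) S) (insert a (nbrs G {a} S))
  have := card_insert_le a (nbrs G {a} S)
  have := hG.card_nbrs_singleton a S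
  have := hG.one_le_degree_bound
  omega

theorem IsCoherent.card_far_le_card_far_insert_insert (hG : IsCoherent G d m) (a b : V)
    (K S : Finset V) : #(far G K S) ≤ #(far G (insert a (insert b K)) S) + 4 * d := by
  have := hG.card_far_le_card_far_insert b K S
  have := hG.card_far_le_card_far_insert a (insert b K) S
  omega

/-- Two arms that are anticomplete to each other except for edges between their tips. -/
structure AreApart (G : SimpleGraph V) (T₁ C₁ T₂ C₂ : Finset V) : Prop where
  separated : IsSeparated G T₁ T₂
  left : IsSeparated G C₁ T₂
  right : IsSeparated G C₂ T₁

theorem AreApart.mono (h : AreApart G T₁ C₁ T₂ C₂) (hD : D ⊆ C₁) (hK : K ⊆ T₂) (hE : E ⊆ C₂) :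
    AreApart G T₁ D K E :=
  ⟨h.separated.mono subset_rfl hK, h.left.mono hD hK, h.right.mono hE subset_rfl⟩

theorem IsCoherent.exists_closesTriangles (hG : IsCoherent G d m) (hodd : OddHoleFree G)
    (h₁ : IsArm G T₁ C₁) (h₂ : IsArm G T₂ C₂) (h₁₂ : AreApart G T₁ C₁ T₂ C₂)
    (hC₁ : 7 * d ≤ #C₁) (hC₂ : 7 * d ≤ #C₂) :
    ∃ a₁ a₂, ∃ D₁ ⊆ C₁, ∃ D₂ ⊆ C₂, #C₁ ≤ 2 * #D₁ + 4 * d ∧ #C₂ ≤ 2 * #D₂ + 4 * d ∧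
      ∀ W, IsSeparated G W (insert a₁ (insert a₂ (T₁ ∪ T₂))) → ClosesTriangles G D₁ W D₂ := by
  have hd := hG.one_le_degree_bound
  have hm := hG.le
  have disjoint : Disjoint C₁ C₂ := h₁.disjoint h₁₂.right
  obtain ⟨a₁, ha₁, a₂, ha₂, hadj⟩ := hG.exists_adj disjoint (by omega) (by omega)
  set K := insert a₂ T₂
  have ha₁K : IsAttached G K a₁ :=
    ⟨by simpa [K, hadj.ne] using (h₁₂.left a₁ ha₁).1, a₂, by simp [K], hadj.symm⟩
  have hC₂' : C₂.erase a₂ ⊆ C₂ := erase_subset _ _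
  obtain ⟨f, g, hfg⟩ := exists_colouring_closesTriangles hodd
    (h₁.mono (far_subset (K := insert a₁ K))) (h₂.insert_tip ha₂)
    (h₁₂.separated.insert_right (h₁₂.right a₂ ha₂)) (h₁.isAttached a₁ ha₁) ha₁K
    isSeparated_far (h₁₂.right.mono hC₂' subset_rfl)
    fun h => Finset.disjoint_left.1 disjoint ha₁ (hC₂' h)
  obtain ⟨e, he⟩ := exists_card_le_two_mul_card_filter (far G (insert a₁ K) C₁) f
  obtain ⟨e', he'⟩ := exists_card_le_two_mul_card_filter (C₂.erase a₂) g
  have card_far : #C₁ ≤ #(far G (insert a₁ K) C₁) + 4 * d := by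
    simpa only [h₁₂.left.far_eq] using hG.card_far_le_card_far_insert_insert a₁ a₂ T₂ C₁
  have card_erase := card_erase_of_mem ha₂
  have hD₁ : {x ∈ far G (insert a₁ K) C₁ | f x = e} ⊆ C₁ := (filter_subset _ _).trans far_subset
  have hD₂ : {b ∈ C₂.erase a₂ | g b = e'} ⊆ C₂ := (filter_subset _ _).trans hC₂'
  refine ⟨a₁, a₂, _, hD₁, _, hD₂, by omega, by omega, fun W hW => hfg e e' ?_ W ?_⟩
  · exact hG.exists_adj (disjoint.mono hD₁ hD₂) (by omega) (by omega)
  · simpa only [K, union_insert] using hW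

theorem IsCoherent.exists_minimal_cover (hG : IsCoherent G d m) (hD : 1 ≤ #D) (hE : 1 ≤ #E)
    (hC : #D ≤ 2 * #(nbrs G C D) ∨ #E ≤ 2 * #(nbrs G C E)) :
    ∃ X ⊆ C, (#D ≤ 2 * #(nbrs G X D) ∨ #E ≤ 2 * #(nbrs G X E)) ∧
      2 * #(nbrs G X D) ≤ #D + 2 * d ∧ 2 * #(nbrs G X E) ≤ #E + 2 * d := by
  induction C using Finset.induction_on with
  | empty =>
    simp only [nbrs_empty, card_empty] at hC
    omega
  | insert b B _ ih =>
    by_cases hB : #D ≤ 2 * #(nbrs G B D) ∨ #E ≤ 2 * #(nbrs G B E)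
    · obtain ⟨X, hX, h⟩ := ih hB
      exact ⟨X, hX.trans (subset_insert _ _), h⟩
    · have := hG.card_nbrs_insert_le b B D
      have := hG.card_nbrs_insert_le b B E
      exact ⟨_, subset_rfl, hC, by omega, by omega⟩

theorem IsCoherent.not_closesTriangles (hG : IsCoherent G d m) (hDE : Disjoint D E)
    (hD : m ≤ #(nbrs G X D)) (hE : #(nbrs G X E) + d ≤ #E) : ¬ ClosesTriangles G X D E := by
  intro h
  have := le_card_sdiff (nbrs G X E) E
  obtain ⟨z, hz, y, hy, hzy⟩ := hG.exists_adj (A := E \ nbrs G X E) (B := nbrs G X D)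
    (hDE.symm.mono sdiff_subset nbrs_subset) (by omega) hD
  obtain ⟨hzE, hzX⟩ := mem_sdiff.1 hz
  obtain ⟨hyD, x, hx, hxy⟩ := mem_nbrs.1 hy
  exact hzX (mem_nbrs.2 ⟨hzE, x, hx, h x hx y hyD z hzE hxy hzy.symm⟩)

theorem ClosesTriangles.symm (h : ClosesTriangles G C W D) : ClosesTriangles G D W C :=
  fun b hb w hw x hx hbw hwx => (h x hx w hw b hb hwx.symm hbw.symm).symm

theorem ClosesTriangles.mono (h : ClosesTriangles G C W D) (hS : S ⊆ C) (hX : X ⊆ D) :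
    ClosesTriangles G S W X :=
  fun x hx w hw b hb => h x (hS hx) w hw b (hX hb)

theorem IsCoherent.false_of_three_arms (hG : IsCoherent G d m) (hodd : OddHoleFree G)
    (h₁ : IsArm G T₁ C₁) (h₂ : IsArm G T₂ C₂) (h₃ : IsArm G T₃ C₃)
    (h₁₂ : AreApart G T₁ C₁ T₂ C₂) (h₁₃ : AreApart G T₁ C₁ T₃ C₃) (h₂₃ : AreApart G T₂ C₂ T₃ C₃)
    (hC₁ : 100 * d ≤ #C₁) (hC₂ : 100 * d ≤ #C₂) (hC₃ : 100 * d ≤ #C₃) : False := by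
  have hd := hG.one_le_degree_bound
  have hm := hG.le
  obtain ⟨a₁, a₂, D₁, hD₁, D₂, hD₂, cardD₁, cardD₂, closes₂⟩ :=
    hG.exists_closesTriangles hodd h₁ h₂ h₁₂ (by omega) (by omega)
  obtain ⟨b₁, b₃, E₁, hE₁, D₃, hD₃, cardE₁, cardD₃, closes₃⟩ :=
    hG.exists_closesTriangles hodd (h₁.mono hD₁) h₃ (h₁₃.mono hD₁ subset_rfl subset_rfl)
      (by omega) (by omega)
  have large_far {S T a b} (hS : IsSeparated G S T) :
      #S ≤ #(far G (insert a (insert b T)) S) + 4 * d := by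
    simpa only [hS.far_eq] using hG.card_far_le_card_far_insert_insert a b T S
  set E₂ := far G (insert b₁ (insert b₃ (T₁ ∪ T₃))) D₂
  set E₃ := far G (insert a₁ (insert a₂ (T₁ ∪ T₂))) D₃
  have cardE₂ : #D₂ ≤ #E₂ + 4 * d := large_far <|
    (isSeparated_union_right.2 ⟨h₁₂.right, h₂₃.left⟩).mono hD₂ subset_rfl
  have cardE₃ : #D₃ ≤ #E₃ + 4 * d := large_far <|
    (isSeparated_union_right.2 ⟨h₁₃.right, h₂₃.right⟩).mono hD₃ subset_rfl
  have disjoint : Disjoint E₂ E₃ :=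
    (h₂.disjoint h₂₃.right).mono (far_subset.trans hD₂) (far_subset.trans hD₃)
  have cover := hG.card_le_card_nbrs_add (B := E₁) (S := E₂) (by omega)
  obtain ⟨X, hX, cover | cover, hX₂, hX₃⟩ := hG.exists_minimal_cover (C := E₁) (D := E₂)
    (E := E₃) (by omega) (by omega) (.inl (by omega))
  · exact hG.not_closesTriangles disjoint (by omega) (by omega)
      ((closes₃ E₂ isSeparated_far).mono hX far_subset)
  · exact hG.not_closesTriangles disjoint.symm (by omega) (by omega)
      ((closes₂ E₃ isSeparated_far).mono (hX.trans hE₁) far_subset)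

theorem card_nbrs_add_card_far_le (h : K ⊆ U) :
    #(nbrs G B W) + #(far G U W) ≤ #(nbrs G (B \ K) (far G U W)) + #W := by
  have inter : nbrs G B W ∩ far G U W ⊆ nbrs G (B \ K) (far G U W) := by
    intro w hw
    obtain ⟨hwB, hwU⟩ := mem_inter.1 hw
    obtain ⟨_, b, hb, hadj⟩ := mem_nbrs.1 hwB
    refine mem_nbrs.2 ⟨hwU, b, mem_sdiff.2 ⟨hb, fun hbK => ?_⟩, hadj⟩
    exact (mem_far.1 hwU).2.2 b (h hbK) hadj
  have := card_le_card inter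
  have := card_le_card
    (union_subset (nbrs_subset (G := G) (B := B) (S := W)) (far_subset (G := G) (K := U)))
  have := card_union_add_card_inter (nbrs G B W) (far G U W)
  omega

theorem IsCoherent.card_le_card_far_insert_insert_add (hG : IsCoherent G d m) (a u : V)
    (K S : Finset V) :
    #S ≤ #(far G (insert a (insert u K)) S) + #(nbrs G K S) + #(S ∩ K) + 4 * d := by
  have := card_le_card_far_add (G := G) (K := K) (S := S)
  have := hG.card_far_le_card_far_insert_insert a u K S
  omega

theorem IsCoherent.exists_isSeparated_or_closesTriangles_of_adj (hG : IsCoherent G d m)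
    (hodd : OddHoleFree G) (hT : IsArm G T C) (hK : IsArm G K (B \ K))
    (hKB : IsSeparated G (K ∪ B) T) (hW : IsSeparated G W T)
    (hKC : #(nbrs G K C) ≤ κ) (hKW : #(nbrs G K W) + #(W ∩ K) ≤ κ)
    (ha : a ∈ C) (hu : u ∈ K ∪ B) (hua : G.Adj u a) :
    ∃ C' ⊆ C, ∃ B' ⊆ B, ∃ W' ⊆ W, #C ≤ 2 * #C' + κ + 4 * d ∧
      #(nbrs G B W) ≤ 2 * #(nbrs G B' W') + κ + 4 * d ∧
      (IsSeparated G C' (K ∪ B') ∨ ClosesTriangles G C' W' B') := by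
  have disjoint : Disjoint C (K ∪ B) := hT.disjoint hKB
  obtain ⟨disjointK, disjointB⟩ := disjoint_union_right.1 disjoint
  have hK'KB : insert u K ⊆ K ∪ B := insert_subset hu subset_union_left
  set U := insert a (insert u K)
  obtain ⟨f, g, hfg⟩ := exists_colouring_closesTriangles hodd
    (hT.mono (far_subset (G := G) (K := U))) (hK.insert_sdiff hu)
    (hKB.mono hK'KB subset_rfl).symm (hT.isAttached a ha)
    ⟨fun h => Finset.disjoint_left.1 disjoint ha (hK'KB h), u, mem_insert_self u K, hua⟩
    isSeparated_far (hKB.mono (sdiff_subset.trans subset_union_right) subset_rfl)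
    fun h => Finset.disjoint_left.1 disjointB ha (mem_sdiff.1 h).1
  obtain ⟨e, he⟩ := exists_card_le_two_mul_card_filter (far G U C) f
  obtain ⟨e', he'⟩ := exists_card_nbrs_le_two_mul_card_nbrs_filter (G := G) (B \ insert u K)
    (far G U W) g
  have farC : #C ≤ #(far G U C) + #(nbrs G K C) + #(C ∩ K) + 4 * d :=
    hG.card_le_card_far_insert_insert_add a u K C
  have farW : #W ≤ #(far G U W) + #(nbrs G K W) + #(W ∩ K) + 4 * d :=
    hG.card_le_card_far_insert_insert_add a u K W
  rw [disjoint_iff_inter_eq_empty.1 disjointK, card_empty] at farC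
  have coverW := card_nbrs_add_card_far_le (G := G) (B := B) (W := W) (U := U)
    (subset_insert a (insert u K))
  have hC' : {x ∈ far G U C | f x = e} ⊆ C := (filter_subset _ _).trans far_subset
  have hB' : {b ∈ B \ insert u K | g b = e'} ⊆ B := (filter_subset _ _).trans sdiff_subset
  refine ⟨_, hC', _, hB', far G U W, far_subset, by omega, by omega, ?_⟩
  by_cases hedge : ∃ x ∈ {x ∈ far G U C | f x = e}, ∃ b ∈ {b ∈ B \ insert u K | g b = e'},
      G.Adj x b
  · refine .inr (hfg e e' hedge _ ?_)
    rw [← union_insert]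
    exact isSeparated_union_right.2 ⟨hW.mono far_subset subset_rfl, isSeparated_far⟩
  · push Not at hedge
    have hKU : K ⊆ U := (subset_insert u K).trans (subset_insert _ _)
    exact .inl (isSeparated_union_right.2 ⟨isSeparated_far.mono (filter_subset _ _) hKU,
      fun c hc => ⟨fun hcB => Finset.disjoint_left.1 disjointB (hC' hc) (hB' hcB),
        fun b hb hbc => hedge c hc b hb hbc.symm⟩⟩)

theorem IsCoherent.exists_isSeparated_or_closesTriangles (hG : IsCoherent G d m)
    (hodd : OddHoleFree G) (hT : IsArm G T C) (hK : IsArm G K (B \ K))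
    (hKB : IsSeparated G (K ∪ B) T) (hW : IsSeparated G W T)
    (hKC : #(nbrs G K C) ≤ κ) (hKW : #(nbrs G K W) + #(W ∩ K) ≤ κ) :
    ∃ C' ⊆ C, ∃ B' ⊆ B, ∃ W' ⊆ W, #C ≤ 2 * #C' + κ + 4 * d ∧
      #(nbrs G B W) ≤ 2 * #(nbrs G B' W') + κ + 4 * d ∧
      (IsSeparated G C' (K ∪ B') ∨ ClosesTriangles G C' W' B') := by
  by_cases h : ∃ a ∈ C, ∃ u ∈ K ∪ B, G.Adj u a
  · obtain ⟨a, ha, u, hu, hua⟩ := h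
    exact hG.exists_isSeparated_or_closesTriangles_of_adj hodd hT hK hKB hW hKC hKW ha hu hua
  · push Not at h
    exact ⟨C, subset_rfl, B, subset_rfl, W, subset_rfl, by omega, by omega,
      .inl fun c hc => ⟨Finset.disjoint_left.1 (hT.disjoint hKB) hc, h c hc⟩⟩

theorem IsCoherent.not_closesTriangles_of_chunks (hG : IsCoherent G d m) (hCW : Disjoint C W)
    (hB : #B ≤ t * s) (hchunk : ∀ P ⊆ B, #P ≤ s → #(nbrs G P C) + d ≤ #C)
    (hW : t * m < #(nbrs G B W)) : ¬ ClosesTriangles G C W B := by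
  intro h
  obtain ⟨P, hP, cardP, coverP⟩ := exists_subset_card_le_card_nbrs_le_mul (G := G) W s t hB
  have large : m ≤ #(nbrs G P W) := by
    by_contra! hlt
    exact (hW.trans_le coverP).not_ge (Nat.mul_le_mul_left t hlt.le)
  exact hG.not_closesTriangles hCW.symm large (hchunk P hP cardP) (h.symm.mono hP subset_rfl)

theorem IsCoherent.exists_isSeparated (hG : IsCoherent G d m)
    (hodd : OddHoleFree G) (hT : IsArm G T C) (hK : IsArm G K (B \ K))
    (hKB : IsSeparated G (K ∪ B) T) (hW : IsSeparated G W T)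
    (hKC : #(nbrs G K C) ≤ κ) (hKW : #(nbrs G K W) + #(W ∩ K) ≤ κ)
    (hB : #B ≤ t * s) (hchunk : ∀ P ⊆ B, #P ≤ s → #(nbrs G P C) ≤ L) (htm : 2 * t * m ≤ d)
    (hC : 2 * L + κ + 6 * d ≤ #C) (hBW : κ + 6 * d ≤ #(nbrs G B W)) :
    ∃ C' ⊆ C, ∃ B' ⊆ B, #C ≤ 2 * #C' + κ + 4 * d ∧
      #(nbrs G B W) ≤ 2 * #(nbrs G B' W) + κ + 4 * d ∧ IsSeparated G C' (K ∪ B') := by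
  have hd := hG.one_le_degree_bound
  obtain ⟨C', hC', B', hB', W', hW', cardC', coverW', h | h⟩ :=
    hG.exists_isSeparated_or_closesTriangles hodd hT hK hKB hW hKC hKW
  · have := card_le_card (nbrs_mono (G := G) (subset_refl B') hW')
    exact ⟨C', hC', B', hB', cardC', by omega, h⟩
  · refine absurd h (hG.not_closesTriangles_of_chunks
      ((hT.disjoint hW).mono hC' hW') ((card_le_card hB').trans hB) (fun P hP cardP => ?_) ?_)
    · have := hchunk P (hP.trans hB') cardP
      have := card_le_card (nbrs_mono (G := G) (subset_refl P) hC')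
      omega
    · rw [mul_assoc] at htm
      omega

end Arms

section Balls

variable {V : Type u} {G : SimpleGraph V} {d m t : ℕ} {A B S S' : Finset V} {u v w : V}
  {k l : ℕ}

/-- The ball of radius `k` around `v` with respect to the paths that stay inside `S` after leaving
`v`. -/
noncomputable def ballIn (G : SimpleGraph V) (S : Finset V) (v : V) : ℕ → Finset V
  | 0 => {v}
  | k + 1 => ballIn G S v k ∪ nbrs G (ballIn G S v k) S

theorem ballIn_mono_radius (h : k ≤ l) : ballIn G S v k ⊆ ballIn G S v l :=
  monotone_nat_of_le_succ (f := ballIn G S v) (fun _ => subset_union_left) h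

theorem nbrs_ballIn_subset : nbrs G (ballIn G S v k) S ⊆ ballIn G S v (k + 1) :=
  subset_union_right

theorem ballIn_subset (hv : v ∈ S) (k : ℕ) : ballIn G S v k ⊆ S := by
  induction k with
  | zero => simpa [ballIn] using hv
  | succ k ih => exact union_subset ih nbrs_subset

theorem ballIn_mono (h : S ⊆ S') (v : V) (k : ℕ) : ballIn G S v k ⊆ ballIn G S' v k := by
  induction k with
  | zero => exact subset_rfl
  | succ k ih => exact union_subset_union ih (nbrs_mono ih h)

theorem isArm_ballIn_sdiff (hB : B ⊆ ballIn G S v (k + 1)) :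
    IsArm G (ballIn G S v k) (B \ ballIn G S v k) := by
  have tips (k : ℕ) : ∀ b ∈ ballIn G S v (k + 1) \ ballIn G S v k,
      IsAttached G (ballIn G S v k) b := fun b hb =>
    have ⟨hb, hbk⟩ := mem_sdiff.1 hb
    ⟨hbk, (mem_nbrs.1 ((mem_union.1 hb).resolve_left hbk)).2⟩
  have connected (k : ℕ) : (G.induce (ballIn G S v k : Set V)).Connected := by
    induction k with
    | zero => rw [ballIn, coe_singleton]; exact .of_subsingleton
    | succ k ih =>
      have := IsArm.connected_union ⟨ih, tips k⟩
      rwa [union_sdiff_of_subset (ballIn_mono_radius k.le_succ)] at this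
  exact ⟨connected k, fun b hb => tips k b (sdiff_subset_sdiff hB subset_rfl hb)⟩

theorem mem_ballIn_add (hu : u ∈ S) (hwu : w ∈ ballIn G S u k) (hwv : w ∈ ballIn G S v l) :
    u ∈ ballIn G S v (l + k) := by
  induction k generalizing l w with
  | zero => rwa [mem_singleton.1 hwu] at hwv
  | succ k ih =>
    rcases mem_union.1 hwu with h | h
    · exact ballIn_mono_radius (by omega) (ih h hwv)
    · obtain ⟨_, x, hx, hxw⟩ := mem_nbrs.1 h
      have hxv := nbrs_ballIn_subset (mem_nbrs.2 ⟨ballIn_subset hu k hx, w, hwv, hxw.symm⟩)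
      exact ballIn_mono_radius (by omega) (ih hx hxv)

theorem exists_cover_or_packing (hA : A ⊆ S) {ρ b : ℕ} (hb : ∀ v ∈ A, b ≤ #(ballIn G S v ρ))
    (n : ℕ) : ∃ F ⊆ A, #F ≤ n ∧
      (A ⊆ F.biUnion (ballIn G S · (2 * ρ)) ∨ n * b ≤ #(F.biUnion (ballIn G S · ρ))) := by
  induction n with
  | zero => exact ⟨∅, empty_subset A, by simp, by simp⟩
  | succ n ih =>
    obtain ⟨F, hFA, hF, cover | packing⟩ := ih
    · exact ⟨F, hFA, by omega, .inl cover⟩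
    by_cases cover : A ⊆ F.biUnion (ballIn G S · (2 * ρ))
    · exact ⟨F, hFA, by omega, .inl cover⟩
    obtain ⟨x, hx, hxF⟩ := not_subset.1 cover
    have disjoint : Disjoint (ballIn G S x ρ) (F.biUnion (ballIn G S · ρ)) := by
      refine Finset.disjoint_left.2 fun w hw hwF => hxF ?_
      obtain ⟨f, hf, hwf⟩ := mem_biUnion.1 hwF
      exact mem_biUnion.2 ⟨f, hf, two_mul ρ ▸ mem_ballIn_add (hA hx) hw hwf⟩
    refine ⟨insert x F, insert_subset hx hFA, (card_insert_le x F).trans (by omega), .inr ?_⟩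
    rw [biUnion_insert, card_union_of_disjoint disjoint, add_mul, one_mul]
    have := hb x hx
    omega

theorem IsCoherent.not_forall_card_ballIn_le (hG : IsCoherent G d m) {ρ b n r : ℕ} (hA : A ⊆ S)
    (hA' : d < #A) (hS : 3 * d < #S) (hb : ∀ v ∈ A, b ≤ #(ballIn G S v ρ)) (hn : m ≤ n * b)
    (hr : n * r ≤ d) : ¬ ∀ v ∈ S, #(ballIn G S v (2 * ρ + 1)) ≤ r := by
  intro small
  obtain ⟨F, hFA, hF, h⟩ := exists_cover_or_packing hA hb n
  have card_le : #(F.biUnion (ballIn G S · (2 * ρ + 1))) ≤ d :=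
    (card_biUnion_le_card_mul _ _ _ fun f hf => small f (hA (hFA hf))).trans
      ((Nat.mul_le_mul_right r hF).trans hr)
  rcases h with cover | packing
  · have := card_le_card (cover.trans (biUnion_mono fun f _ =>
      ballIn_mono_radius (G := G) (S := S) (v := f) (by omega : 2 * ρ ≤ 2 * ρ + 1)))
    omega
  · have reach : nbrs G (F.biUnion (ballIn G S · ρ)) S ⊆
        F.biUnion (ballIn G S · (2 * ρ + 1)) := by
      intro x hx
      obtain ⟨hxS, y, hy, hyx⟩ := mem_nbrs.1 hx
      obtain ⟨f, hf, hyf⟩ := mem_biUnion.1 hy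
      exact mem_biUnion.2 ⟨f, hf, ballIn_mono_radius (by omega : ρ + 1 ≤ 2 * ρ + 1)
        (nbrs_ballIn_subset (mem_nbrs.2 ⟨hxS, y, hyf, hyx⟩))⟩
    have := card_le_card reach
    have := hG.card_le_card_nbrs_add (S := S) (hn.trans packing)
    omega

theorem exists_le_mul_and_mul_mul_le {b : ℕ} (hb : 1 ≤ b) (hbm : b ≤ m) (htm : 2 * t * m ≤ d) :
    ∃ n, m ≤ n * b ∧ n * (b * t) ≤ d := by
  refine ⟨m / b + 1, (Nat.lt_mul_of_div_lt (Nat.lt_succ_self _) hb).le, ?_⟩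
  calc (m / b + 1) * (b * t) = (m / b * b + b) * t := by ring
    _ ≤ (m + m) * t := by gcongr; exact Nat.div_mul_le_self m b
    _ ≤ d := by linarith

theorem IsCoherent.exists_min_le_card_ballIn (hG : IsCoherent G d m) (ht : 1 ≤ t)
    (htm : 2 * t * m ≤ d) (i : ℕ) (hS : (i + 1) * (3 * d) < #S) :
    ∃ v ∈ S, min (t ^ i) m ≤ #(ballIn G S v (2 ^ i - 1)) := by
  induction i generalizing S with
  | zero =>
    obtain ⟨v, hv⟩ := card_pos.1 (by omega : 0 < #S)
    exact ⟨v, hv, by simp [ballIn]⟩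
  | succ i ih =>
    set ρ := 2 ^ i - 1
    have radius : 2 ^ (i + 1) - 1 = 2 * ρ + 1 := by
      have := Nat.one_le_two_pow (n := i)
      rw [pow_succ]
      omega
    rw [radius]
    by_contra! small
    set good := {v ∈ S | min (t ^ i) m ≤ #(ballIn G S v ρ)}
    set bad := {v ∈ S | ¬ min (t ^ i) m ≤ #(ballIn G S v ρ)}
    have few_bad : #bad ≤ (i + 1) * (3 * d) := by
      by_contra! hbad
      obtain ⟨v, hv, hball⟩ := ih hbad
      exact (mem_filter.1 hv).2
        (hball.trans (card_le_card (ballIn_mono (filter_subset _ _) v ρ)))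
    have many_good : 3 * d < #good := by
      have : #good + #bad = #S := card_filter_add_card_filter_not _
      rw [add_mul _ 1] at hS
      omega
    have hgood : good ⊆ S := filter_subset _ _
    have lt_m (v) (hv : v ∈ S) : #(ballIn G S v ρ) < m :=
      (card_le_card (ballIn_mono_radius (by omega))).trans_lt
        ((small v hv).trans_le (min_le_right _ _))
    have le_card (v) (hv : v ∈ good) : t ^ i ≤ #(ballIn G S v ρ) :=
      (min_le_iff.1 (mem_filter.1 hv).2).resolve_right (lt_m v (hgood hv)).not_ge
    obtain ⟨v, hv⟩ := card_pos.1 (by omega : 0 < #good)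
    obtain ⟨n, hn, hn'⟩ := exists_le_mul_and_mul_mul_le (Nat.one_le_pow i t ht)
      ((le_card v hv).trans (lt_m v (hgood hv)).le) htm
    exact hG.not_forall_card_ballIn_le hgood (by omega) (many_good.trans_le (card_le_card hgood))
      le_card hn hn' fun v hv => (small v hv).le.trans (min_le_left _ _)

theorem IsCoherent.exists_card_le_card_ballIn_add (hG : IsCoherent G d m) (ht : 1 ≤ t)
    (htm : 2 * t * m ≤ d) {q : ℕ} (hq : m ≤ t ^ q) (hS : (q + 1) * (3 * d) < #S) :
    ∃ v ∈ S, #S ≤ #(ballIn G S v (2 ^ q)) + 2 * d := by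
  obtain ⟨v, hv, hball⟩ := hG.exists_min_le_card_ballIn ht htm q hS
  rw [min_eq_right hq] at hball
  have := card_le_card (nbrs_ballIn_subset (G := G) (S := S) (v := v) (k := 2 ^ q - 1))
  rw [Nat.sub_add_cancel Nat.one_le_two_pow] at this
  have := hG.card_le_card_nbrs_add (S := S) hball
  exact ⟨v, hv, by omega⟩

end Balls

section Stability

variable {V : Type u} {G : SimpleGraph V} {d m t q k r s κ L E E' j : ℕ} {S S' : Finset V}

theorem exists_stable_level {P : ℕ → Finset V → Prop} (h0 : P 0 S)
    (hq : ∀ S' ⊆ S, #S ≤ #S' + q * E → ¬ P q S') :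
    ∃ j < q, ∃ S' ⊆ S, #S ≤ #S' + j * E ∧ P j S' ∧
      ∀ S'' ⊆ S', #S' ≤ #S'' + E → ¬ P (j + 1) S'' := by
  induction q generalizing P S with
  | zero => exact absurd h0 (hq S subset_rfl (by omega))
  | succ q ih =>
    by_cases h : ∃ S' ⊆ S, #S ≤ #S' + E ∧ P 1 S'
    · obtain ⟨S₁, hS₁, card₁, h₁⟩ := h
      obtain ⟨j, hj, S', hS', cardS', hP, hlast⟩ := ih (P := fun j => P (j + 1)) h₁
        fun S' hS' cardS' => hq S' (hS'.trans hS₁) (by rw [Nat.succ_mul]; omega)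
      exact ⟨j + 1, by omega, S', hS'.trans hS₁, by rw [Nat.succ_mul]; omega, hP, hlast⟩
    · push Not at h
      exact ⟨0, by omega, S, subset_rfl, by omega, h0, h⟩

/-- Every set of at most `s` vertices in a ball of radius `r` of `S` covers less than `L` vertices
of `S`. -/
def CoversFew (G : SimpleGraph V) (r L s : ℕ) (S : Finset V) : Prop :=
  ∀ v ∈ S, ∀ B ⊆ ballIn G S v r, #B ≤ s → #(nbrs G B S) < L

/-- The number of vertices of a ball of radius `r` needed to cover `L` vertices of `S` is more than
`t ^ j`, and it stays at most `t ^ (j + 1)` when up to `E` vertices of `S` are deleted. -/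
structure HasStableCost (G : SimpleGraph V) (r t L E j : ℕ) (S : Finset V) : Prop where
  coversFew : CoversFew G r L (t ^ j) S
  not_coversFew : ∀ S' ⊆ S, #S ≤ #S' + E → ¬ CoversFew G r L (t ^ (j + 1)) S'

theorem CoversFew.mono (h : CoversFew G r L s S) (hS : S' ⊆ S) : CoversFew G r L s S' :=
  fun v hv B hB hBs => (card_le_card (nbrs_mono subset_rfl hS)).trans_lt
    (h v (hS hv) B (hB.trans (ballIn_mono hS v r)) hBs)

theorem HasStableCost.mono (h : HasStableCost G r t L (E + E') j S) (hS : S' ⊆ S)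
    (hcard : #S ≤ #S' + E) : HasStableCost G r t L E' j S' :=
  ⟨h.coversFew.mono hS, fun S'' hS'' hcard' => h.not_coversFew S'' (hS''.trans hS) (by omega)⟩

theorem HasStableCost.of_le (h : HasStableCost G r t L E j S) (hE : E' ≤ E) :
    HasStableCost G r t L E' j S :=
  ⟨h.coversFew, fun S' hS' hcard => h.not_coversFew S' hS' (by omega)⟩

theorem HasStableCost.exists_trimmed_cover (h : HasStableCost G r t L E j S)
    (hG : IsCoherent G d m) (hS' : S' ⊆ S) (hcard : #S ≤ #S' + E) :
    ∃ v ∈ S', ∃ B ⊆ ballIn G S' v r, #B ≤ t * t ^ j ∧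
      L ≤ #(nbrs G B S') ∧ #(nbrs G B S') ≤ L + d := by
  have := h.not_coversFew S' hS' hcard
  simp only [CoversFew] at this
  push Not at this
  obtain ⟨v, hv, B, hB, cardB, hL⟩ := this
  obtain ⟨B', hB', hL', hL''⟩ := hG.exists_subset_card_nbrs_le hL
  exact ⟨v, hv, B', hB'.trans hB, (card_le_card hB').trans (by rwa [mul_comm, ← pow_succ]),
    hL', hL''⟩

theorem IsCoherent.exists_hasStableCost (hG : IsCoherent G d m) (hL : d < L) (hcard : #S < t ^ q)
    (hS : ∀ S' ⊆ S, #S ≤ #S' + q * E → ∃ v ∈ S', L ≤ #(nbrs G (ballIn G S' v r) S')) :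
    ∃ i < q, ∃ S' ⊆ S, ∃ j, #S ≤ #S' + i * E ∧ HasStableCost G r t L E j S' := by
  have few : CoversFew G r L (t ^ 0) S := by
    intro v _ B _ cardB
    rw [pow_zero] at cardB
    have := hG.card_nbrs_le_mul B S
    have := Nat.mul_le_mul_right d cardB
    omega
  have many : ∀ S' ⊆ S, #S ≤ #S' + q * E → ¬ CoversFew G r L (t ^ q) S' := by
    intro S' hS' hcard' hfew
    obtain ⟨v, hv, hL⟩ := hS S' hS' hcard'
    have ball_le := card_le_card ((ballIn_subset (G := G) hv r).trans hS')
    exact (hfew v hv _ subset_rfl (ball_le.trans hcard.le)).not_ge hL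
  obtain ⟨j, hj, S', hS', hcard, hfew, hmany⟩ :=
    exists_stable_level (P := fun j => CoversFew G r L (t ^ j)) few many
  exact ⟨j, hj, S', hS', j, hcard, hfew, hmany⟩

theorem IsCoherent.exists_stable_radius (hG : IsCoherent G d m) (ht : 1 ≤ t) (htm : 2 * t * m ≤ d)
    {X : ℕ} (hcard : #S < t ^ q)
    (hS : 2 ^ q * E + (3 * (q + 1) + 2 * X ^ 2 ^ q + 2) * d < #S) :
    ∃ k < 2 ^ q, ∃ S' ⊆ S, (∀ v ∈ S', #(ballIn G S' v (k + 1)) ≤ 2 * d * X ^ k) ∧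
      ∀ S'' ⊆ S', #S' ≤ #S'' + E → ∃ v ∈ S'', 2 * d * X ^ (k + 1) < #(ballIn G S'' v (k + 2)) := by
  have small : ∀ v ∈ S, #(ballIn G S v 1) ≤ 2 * d * X ^ 0 := by
    intro v _
    have := card_union_le {v} (nbrs G {v} S)
    have := hG.card_nbrs_singleton v S
    have := hG.one_le_degree_bound
    rw [card_singleton] at *
    simp only [ballIn, pow_zero]
    omega
  have large : ∀ S' ⊆ S, #S ≤ #S' + 2 ^ q * E →
      ¬ ∀ v ∈ S', #(ballIn G S' v (2 ^ q + 1)) ≤ 2 * d * X ^ 2 ^ q := by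
    intro S' _ _ hsmall
    have split : (3 * (q + 1) + 2 * X ^ 2 ^ q + 2) * d =
      (q + 1) * (3 * d) + 2 * d * X ^ 2 ^ q + 2 * d := by ring
    have hm : m ≤ t ^ q := by
      have := hG.le
      omega
    obtain ⟨v, hv, hball⟩ := hG.exists_card_le_card_ballIn_add (S := S') ht htm hm (by omega)
    have := hsmall v hv
    have := card_le_card (ballIn_mono_radius (G := G) (S := S') (v := v) (2 ^ q).le_succ)
    simp only [Nat.succ_eq_add_one] at this
    omega
  obtain ⟨k, hk, S', hS', -, hsmall, hlarge⟩ := exists_stable_level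
    (P := fun k S => ∀ v ∈ S, #(ballIn G S v (k + 1)) ≤ 2 * d * X ^ k) small large
  refine ⟨k, hk, S', hS', hsmall, fun S'' hS'' hcard' => ?_⟩
  simpa only [not_forall, not_le, exists_prop] using hlarge S'' hS'' hcard'

/-- In `S`, balls of radius `k + 1` are small but one of them covers many vertices, and the costs of
covering two intermediate numbers of vertices are stable. The gaps between the powers of `10` leave
room for the losses in the construction of three arms. -/
structure IsStable (G : SimpleGraph V) (d t k κ : ℕ) (S : Finset V) : Prop where
  two_mul_le : 2 * d ≤ κ
  card_ballIn_le : ∀ v ∈ S, #(ballIn G S v (k + 1)) ≤ κ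
  exists_le_card_nbrs : ∃ v ∈ S, 10 ^ 7 * κ ≤ #(nbrs G (ballIn G S v (k + 1)) S)
  exists_high_cost : ∃ j, HasStableCost G (k + 1) t (10 ^ 5 * κ) (10 ^ 8 * κ) j S
  exists_low_cost : ∃ j, HasStableCost G (k + 1) t (10 ^ 3 * κ) (10 ^ 8 * κ) j S

theorem IsCoherent.exists_isStable_of_forall (hG : IsCoherent G d m) (hκ : 2 * d ≤ κ)
    (hcard : #S < t ^ q) (hball : ∀ v ∈ S, #(ballIn G S v (k + 1)) ≤ κ)
    (hcover : ∀ S' ⊆ S, #S ≤ #S' + q * (q * (10 ^ 8 * κ)) →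
      ∃ v ∈ S', 10 ^ 7 * κ ≤ #(nbrs G (ballIn G S' v (k + 1)) S')) :
    ∃ S', IsStable G d t k κ S' := by
  have hd := hG.one_le_degree_bound
  set E := 10 ^ 8 * κ
  obtain ⟨i₁, hi₁, S₁, hS₁, j₁, card₁, cost₁⟩ := hG.exists_hasStableCost (r := k + 1)
    (L := 10 ^ 5 * κ) (E := q * E) (by omega) hcard fun S' hS' hcard' =>
      let ⟨v, hv, hL⟩ := hcover S' hS' hcard'
      ⟨v, hv, hL.trans' (by omega)⟩
  have within₁ : i₁ * (q * E) + q * E ≤ q * (q * E) := by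
    rw [← Nat.succ_mul]
    exact Nat.mul_le_mul_right _ hi₁
  obtain ⟨i₂, hi₂, S₂, hS₂, j₂, card₂, cost₂⟩ := hG.exists_hasStableCost (r := k + 1)
    (L := 10 ^ 3 * κ) (E := E) (by omega) ((card_le_card hS₁).trans_lt hcard)
    fun S' hS' hcard' =>
      let ⟨v, hv, hL⟩ := hcover S' (hS'.trans hS₁) (by omega)
      ⟨v, hv, hL.trans' (by omega)⟩
  have within₂ : i₂ * E + E ≤ q * E := by
    rw [← Nat.succ_mul]
    exact Nat.mul_le_mul_right _ hi₂
  exact ⟨S₂, hκ, fun v hv => (card_le_card (ballIn_mono (hS₂.trans hS₁) v _)).trans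
    (hball v (hS₁ (hS₂ hv))), hcover S₂ (hS₂.trans hS₁) (by omega),
    ⟨j₁, (cost₁.of_le within₂).mono hS₂ card₂⟩, j₂, cost₂⟩

/-- The factor by which a large coherent graph must exceed its degree bound in order to contain a
stable set. -/
def stabilityBound (q : ℕ) : ℕ :=
  2 ^ q * (q * (q * (2 * (10 ^ 8) ^ 2 ^ q))) + (3 * (q + 1) + 2 * (10 ^ 8) ^ 2 ^ q + 2)

theorem IsCoherent.exists_isStable (hG : IsCoherent G d m) (ht : 1 ≤ t) (htm : 2 * t * m ≤ d)
    (hcard : #S < t ^ q) (hS : stabilityBound q * d < #S) :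
    ∃ k κ S', IsStable G d t k κ S' := by
  obtain ⟨k, hk, S, hS, hball, hlarge⟩ := hG.exists_stable_radius (X := 10 ^ 8)
    (E := q * (q * (2 * d * (10 ^ 8) ^ 2 ^ q))) ht htm hcard (by
      rw [stabilityBound] at hS
      linarith)
  set κ := 2 * d * (10 ^ 8) ^ k
  have hκ : 2 * d ≤ κ := Nat.le_mul_of_pos_right _ (by positivity)
  have next : 2 * d * (10 ^ 8) ^ (k + 1) = 10 ^ 8 * κ := by ring
  have le_last : 10 ^ 8 * κ ≤ 2 * d * (10 ^ 8) ^ 2 ^ q :=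
    next ▸ Nat.mul_le_mul_left _ (Nat.pow_le_pow_right (by norm_num) hk)
  refine ⟨k, κ, hG.exists_isStable_of_forall hκ ((card_le_card hS).trans_lt hcard) hball
    fun S' hS' hcard' => ?_⟩
  obtain ⟨v, hv, hvk⟩ := hlarge S' hS' (hcard'.trans (by gcongr))
  rw [next] at hvk
  refine ⟨v, hv, ?_⟩
  have := hball v (hS' hv)
  have := card_le_card (ballIn_mono (G := G) hS' v (k + 1))
  have := card_union_le (ballIn G S' v (k + 1)) (nbrs G (ballIn G S' v (k + 1)) S')
  rw [ballIn] at hvk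
  omega

end Stability

section ThreeArms

variable {V : Type u} {G : SimpleGraph V} {d m t q k s n κ L : ℕ}
  {B B' C S T W : Finset V} {v : V}

/-- The stem of the arm shot from `v` into `W`: the ball of radius `k` together with a set `B` of
vertices of the ball of radius `k + 1`. -/
noncomputable def stem (G : SimpleGraph V) (W : Finset V) (v : V) (k : ℕ) (B : Finset V) :
    Finset V :=
  ballIn G W v k ∪ B

/-- The tips of the arm with stem `stem G W v k B`. -/
noncomputable def tips (G : SimpleGraph V) (W : Finset V) (v : V) (k : ℕ) (B : Finset V) :
    Finset V :=
  nbrs G B W \ ballIn G W v (k + 1)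

/-- What remains of `W`, for the construction of further arms, next to the arm with stem
`stem G W v k B`. -/
noncomputable def remainder (G : SimpleGraph V) (W : Finset V) (v : V) (k : ℕ) (B : Finset V) :
    Finset V :=
  (W \ ballIn G W v (k + 1)) \ nbrs G B W

theorem stem_mono (h : B' ⊆ B) : stem G W v k B' ⊆ stem G W v k B :=
  union_subset_union subset_rfl h

theorem stem_subset_ballIn (hB : B ⊆ ballIn G W v (k + 1)) :
    stem G W v k B ⊆ ballIn G W v (k + 1) :=
  union_subset (ballIn_mono_radius k.le_succ) hB

theorem stem_subset (hB : B ⊆ ballIn G W v (k + 1)) (hv : v ∈ W) : stem G W v k B ⊆ W :=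
  (stem_subset_ballIn hB).trans (ballIn_subset hv _)

theorem tips_mono (h : B' ⊆ B) : tips G W v k B' ⊆ tips G W v k B :=
  sdiff_subset_sdiff (nbrs_mono h subset_rfl) subset_rfl

theorem tips_subset : tips G W v k B ⊆ W :=
  sdiff_subset.trans nbrs_subset

theorem remainder_subset : remainder G W v k B ⊆ W :=
  sdiff_subset.trans sdiff_subset

theorem card_nbrs_le_card_tips_add (hκ : #(ballIn G W v (k + 1)) ≤ κ) :
    #(nbrs G B W) ≤ #(tips G W v k B) + κ := by
  have := le_card_sdiff (ballIn G W v (k + 1)) (nbrs G B W)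
  rw [tips]
  omega

theorem card_le_card_remainder_add (hκ : #(ballIn G W v (k + 1)) ≤ κ) :
    #W ≤ #(remainder G W v k B) + #(nbrs G B W) + κ := by
  have := le_card_sdiff (ballIn G W v (k + 1)) W
  have := le_card_sdiff (nbrs G B W) (W \ ballIn G W v (k + 1))
  rw [remainder]
  omega

theorem isArm_stem (hB : B ⊆ ballIn G W v (k + 1)) :
    IsArm G (stem G W v k B) (tips G W v k B) := by
  refine ⟨?_, fun c hc => ?_⟩
  · have := (isArm_ballIn_sdiff hB).connected_union
    rwa [union_sdiff_self_eq_union] at this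
  · obtain ⟨hcB, hc⟩ := mem_sdiff.1 hc
    obtain ⟨_, b, hb, hbc⟩ := mem_nbrs.1 hcB
    exact ⟨fun h => hc (stem_subset_ballIn hB h), b, mem_union_right _ hb, hbc⟩

theorem isSeparated_remainder (hB : B ⊆ ballIn G W v (k + 1)) :
    IsSeparated G (remainder G W v k B) (stem G W v k B) := by
  intro w hw
  simp only [remainder, mem_sdiff] at hw
  obtain ⟨⟨hwW, hwball⟩, hwB⟩ := hw
  refine ⟨fun h => hwball (stem_subset_ballIn hB h), fun x hx hxw => ?_⟩
  rcases mem_union.1 hx with hx | hx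
  · exact hwball (nbrs_ballIn_subset (mem_nbrs.2 ⟨hwW, x, hx, hxw⟩))
  · exact hwB (mem_nbrs.2 ⟨hwW, x, hx, hxw⟩)

/-- An arm with at least `n` tips, all in `S`, whose stem is separated from `W`. -/
structure IsArmBeside (G : SimpleGraph V) (S W : Finset V) (n : ℕ) (T C : Finset V) : Prop
    extends IsArm G T C where
  tips_subset : C ⊆ S
  isSeparated : IsSeparated G W T
  le_card : n ≤ #C

theorem IsCoherent.exists_areApart (hG : IsCoherent G d m) (hodd : OddHoleFree G)
    (htm : 2 * t * m ≤ d) (hκ : 2 * d ≤ κ) (hball : ∀ v ∈ S, #(ballIn G S v (k + 1)) ≤ κ)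
    (hfew : CoversFew G (k + 1) L s S) (hT : IsArmBeside G S W n T C) (hW : W ⊆ S) (hv : v ∈ W)
    (hB : B ⊆ ballIn G W v (k + 1)) (cardB : #B ≤ t * s) (hn : 2 * L + 5 * κ ≤ n)
    (hBW : 5 * κ ≤ #(nbrs G B W)) :
    ∃ C' ⊆ C, ∃ B' ⊆ B, #C ≤ 2 * #C' + 4 * κ ∧ #(nbrs G B W) ≤ 2 * #(nbrs G B' W) + 4 * κ ∧
      AreApart G T C' (stem G W v k B') (tips G W v k B') := by
  have hvS := hW hv
  have ball_le : #(ballIn G W v (k + 1)) ≤ κ :=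
    (card_le_card (ballIn_mono hW v _)).trans (hball v hvS)
  have nbrs_le (X) (hX : X ⊆ S) : #(nbrs G (ballIn G W v k) X) ≤ κ :=
    (card_le_card ((nbrs_mono (ballIn_mono hW v k) hX).trans nbrs_ballIn_subset)).trans
      (hball v hvS)
  have inter_le : #(W ∩ ballIn G W v k) ≤ κ :=
    (card_le_card (inter_subset_right.trans (ballIn_mono_radius k.le_succ))).trans ball_le
  have := nbrs_le C hT.tips_subset
  have := nbrs_le W hW
  have := hT.le_card
  obtain ⟨C', hC', B', hB', cardC', coverB', hsep⟩ := hG.exists_isSeparated (κ := 2 * κ) hodd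
    hT.toIsArm (isArm_ballIn_sdiff hB) (hT.isSeparated.mono (stem_subset hB hv) subset_rfl)
    hT.isSeparated (by omega) (by omega) cardB
    (fun P hP cardP => (card_le_card (nbrs_mono subset_rfl hT.tips_subset)).trans
      (hfew v hvS P (hP.trans (hB.trans (ballIn_mono hW v _))) cardP).le)
    htm (by omega) (by omega)
  exact ⟨C', hC', B', hB', by omega, by omega,
    (hT.isSeparated.mono (stem_subset (hB'.trans hB) hv) subset_rfl).symm, hsep,
    hT.isSeparated.mono tips_subset subset_rfl⟩

theorem IsStable.exists_arm (hS : IsStable G d t k κ S) (hG : IsCoherent G d m) :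
    ∃ W ⊆ S, ∃ T C, IsArmBeside G S W (10 ^ 6 * κ) T C ∧ #S ≤ #W + 10 ^ 7 * κ + 2 * κ := by
  obtain ⟨v, hv, hcover⟩ := hS.exists_le_card_nbrs
  obtain ⟨B, hB, hL, hL'⟩ := hG.exists_subset_card_nbrs_le hcover
  have hκ := hS.two_mul_le
  have ball_le := hS.card_ballIn_le v hv
  have := card_nbrs_le_card_tips_add (B := B) ball_le
  have := card_le_card_remainder_add (B := B) ball_le
  exact ⟨remainder G S v k B, remainder_subset, stem G S v k B, tips G S v k B,
    ⟨isArm_stem hB, tips_subset, isSeparated_remainder hB, by omega⟩, by omega⟩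

theorem IsStable.exists_two_arms (hS : IsStable G d t k κ S) (hG : IsCoherent G d m)
    (hodd : OddHoleFree G) (htm : 2 * t * m ≤ d) :
    ∃ W ⊆ S, ∃ T₁ C₁ T₂ C₂, IsArmBeside G S W (10 ^ 4 * κ) T₁ C₁ ∧
      IsArmBeside G S W (10 ^ 4 * κ) T₂ C₂ ∧ AreApart G T₁ C₁ T₂ C₂ ∧ #S ≤ #W + 10 ^ 8 * κ := by
  have hκ := hS.two_mul_le
  obtain ⟨W₁, hW₁, T₁, C₁, hT₁, cardW₁⟩ := hS.exists_arm hG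
  obtain ⟨j, cost⟩ := hS.exists_high_cost
  obtain ⟨v, hv, B, hB, cardB, hL, hL'⟩ := cost.exists_trimmed_cover hG hW₁ (by omega)
  obtain ⟨C, hC, B', hB', cardC, coverB', apart⟩ := hG.exists_areApart hodd htm hκ
    hS.card_ballIn_le cost.coversFew hT₁ hW₁ hv hB cardB (by omega) (by omega)
  have ball_le : #(ballIn G W₁ v (k + 1)) ≤ κ :=
    (card_le_card (ballIn_mono hW₁ v _)).trans (hS.card_ballIn_le v (hW₁ hv))
  have := card_nbrs_le_card_tips_add (B := B') ball_le
  have := card_le_card_remainder_add (B := B) ball_le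
  have := hT₁.le_card
  exact ⟨remainder G W₁ v k B, remainder_subset.trans hW₁, T₁, C, _, _,
    ⟨hT₁.toIsArm.mono hC, hC.trans hT₁.tips_subset,
      hT₁.isSeparated.mono remainder_subset subset_rfl, by omega⟩,
    ⟨isArm_stem (hB'.trans hB), tips_subset.trans hW₁,
      (isSeparated_remainder hB).mono subset_rfl (stem_mono hB'), by omega⟩, apart, by omega⟩

theorem IsStable.false (hS : IsStable G d t k κ S) (hG : IsCoherent G d m)
    (hodd : OddHoleFree G) (htm : 2 * t * m ≤ d) : False := by
  have hκ := hS.two_mul_le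
  obtain ⟨W, hW, T₁, C₁, T₂, C₂, hT₁, hT₂, apart₁₂, cardW⟩ := hS.exists_two_arms hG hodd htm
  obtain ⟨j, cost⟩ := hS.exists_low_cost
  obtain ⟨v, hv, B, hB, cardB, hL, -⟩ := cost.exists_trimmed_cover hG hW cardW
  obtain ⟨D₁, hD₁, B₁, hB₁, cardD₁, coverB₁, apart₁⟩ := hG.exists_areApart hodd htm hκ
    hS.card_ballIn_le cost.coversFew hT₁ hW hv hB cardB (by omega) (by omega)
  obtain ⟨D₂, hD₂, B₂, hB₂, cardD₂, coverB₂, apart₂⟩ := hG.exists_areApart hodd htm hκ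
    hS.card_ballIn_le cost.coversFew hT₂ hW hv (hB₁.trans hB) ((card_le_card hB₁).trans cardB)
    (by omega) (by omega)
  have := card_nbrs_le_card_tips_add (B := B₂)
    ((card_le_card (ballIn_mono hW v _)).trans (hS.card_ballIn_le v (hW hv)))
  have := hT₁.le_card
  have := hT₂.le_card
  exact hG.false_of_three_arms hodd (hT₁.toIsArm.mono hD₁) (hT₂.toIsArm.mono hD₂)
    (isArm_stem (hB₂.trans (hB₁.trans hB))) (apart₁₂.mono hD₁ subset_rfl hD₂)
    (apart₁.mono subset_rfl (stem_mono hB₂) (tips_mono hB₂)) apart₂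
    (by omega) (by omega) (by omega)

theorem IsCoherent.card_le_stabilityBound_mul (hG : IsCoherent G d m) (hodd : OddHoleFree G)
    (ht : 1 ≤ t) (htm : 2 * t * m ≤ d) (hcard : #S < t ^ q) : #S ≤ stabilityBound q * d := by
  by_contra! hS
  obtain ⟨k, κ, S', stable⟩ := hG.exists_isStable ht htm hcard hS
  exact stable.false hG hodd htm

end ThreeArms

section Roedl

variable {V : Type u} {G : SimpleGraph V} {A B U X Y : Finset V} {k s u w : ℕ}
  {δ ε σ : ℝ}

/-- Every vertex of `A` has at most `δ * #B` neighbours in `B`. -/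
def IsSparseTo (G : SimpleGraph V) (δ : ℝ) (A B : Finset V) : Prop :=
  ∀ a ∈ A, (#(nbrs G {a} B) : ℝ) ≤ δ * #B

theorem card_interedges_eq_sum_card_nbrs (A B : Finset V) :
    #(G.interedges A B) = ∑ a ∈ A, #(nbrs G {a} B) := by
  rw [interedges_def, card_filter, sum_product]
  simp only [nbrs, mem_singleton, exists_eq_left, card_filter]

theorem IsSparseTo.card_interedges_le (h : IsSparseTo G δ A B) :
    (#(G.interedges A B) : ℝ) ≤ δ * (#A * #B) := by
  rw [card_interedges_eq_sum_card_nbrs, Nat.cast_sum]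
  calc ∑ a ∈ A, (#(nbrs G {a} B) : ℝ) ≤ #A • (δ * #B) := sum_le_card_nsmul _ _ _ h
    _ = δ * (#A * #B) := by rw [nsmul_eq_mul]; ring

theorem exists_isSparseTo_of_forall_exists_card_nbrs_le (hδ : 0 < δ) {F : Fin k → SimpleGraph V}
    {S : Fin k → Finset V} (hA : #A = u) (hu : 0 < u) (hS : ∀ j, #(S j) = u)
    (hfew : ∀ v ∈ A, ∃ j, (#(nbrs (F j) {v} (S j)) : ℝ) ≤ δ / (k + 1) * u) :
    ∃ j, ∃ A' ⊆ A, ∃ B ⊆ S j, #A' = #B ∧ (u / (k + 1) : ℝ) ≤ #B ∧ IsSparseTo (F j) δ A' B := by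
  obtain ⟨v₀, hv₀⟩ := card_pos.1 (hA ▸ hu)
  have : Nonempty (Fin k) := ⟨(hfew v₀ hv₀).choose⟩
  choose! f hf using hfew
  have pigeons : #(univ : Finset (Fin k)) • (u / (k + 1) : ℝ) ≤ #A := by
    rw [card_univ, Fintype.card_fin, nsmul_eq_mul, hA, mul_div_left_comm]
    exact mul_le_of_le_one_right (by positivity) (div_le_one_of_le₀ (by linarith) (by positivity))
  obtain ⟨j, -, hj⟩ := exists_le_card_fiber_of_nsmul_le_card_of_maps_to
    (fun v _ => mem_univ (f v)) univ_nonempty pigeons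
  have hwu : ⌈(u / (k + 1) : ℝ)⌉₊ ≤ u :=
    Nat.ceil_le.2 (div_le_self (by positivity) (by linarith [k.cast_nonneg (α := ℝ)]))
  obtain ⟨A', hA', cardA'⟩ := exists_subset_card_eq (Nat.ceil_le.2 hj)
  obtain ⟨B, hB, cardB⟩ := exists_subset_card_eq (hwu.trans (hS j).ge)
  have hBu : (u / (k + 1) : ℝ) ≤ #B := cardB ▸ Nat.le_ceil _
  refine ⟨j, A', hA'.trans (filter_subset _ _), B, hB, cardA'.trans cardB.symm, hBu, ?_⟩
  intro v hv
  obtain ⟨hvA, rfl⟩ := mem_filter.1 (hA' hv)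
  calc (#(nbrs (F (f v)) {v} B) : ℝ) ≤ #(nbrs (F (f v)) {v} (S (f v))) := by
        exact_mod_cast card_le_card (nbrs_mono subset_rfl hB)
    _ ≤ δ / (k + 1) * u := hf v hvA
    _ = δ * (u / (k + 1)) := by ring
    _ ≤ δ * #B := by gcongr

theorem exists_transversal_copy_cons {H : SimpleGraph (Fin (k + 1))} {S : Fin (k + 1) → Finset V}
    {v : V} (hv : v ∈ S 0) {h : Fin k → V}
    (hh : ∀ j, h j ∈ nbrs (if H.Adj 0 j.succ then G else Gᶜ) {v} (S j.succ))
    (hadj : ∀ i j, G.Adj (h i) (h j) ↔ H.Adj i.succ j.succ) :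
    ∃ h : Fin (k + 1) → V, (∀ i, h i ∈ S i) ∧ ∀ i j, G.Adj (h i) (h j) ↔ H.Adj i j := by
  have hadj₀ : ∀ j, G.Adj v (h j) ↔ H.Adj 0 j.succ := by
    intro j
    have := (mem_nbrs.1 (hh j)).2
    split_ifs at this with hH <;> simp_all [compl_adj]
  refine ⟨Fin.cons v h, ?_, ?_⟩
  · exact Fin.cases hv fun j => nbrs_subset (hh j)
  · refine Fin.cases (Fin.cases (by simp) fun j => by simp [hadj₀]) fun i =>
      Fin.cases ?_ fun j => ?_
    · simp [G.adj_comm (h i), H.adj_comm i.succ, hadj₀]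
    · simp [hadj]

theorem exists_transversal_copy_or_isSparseTo (hδ : 0 < δ) (H : SimpleGraph (Fin k)) :
    ∃ σ : ℝ, 0 < σ ∧ ∀ (V : Type u) (G : SimpleGraph V) (S : Fin k → Finset V) (u : ℕ), 0 < u →
      (∀ i, #(S i) = u) →
      (∃ h : Fin k → V, (∀ i, h i ∈ S i) ∧ ∀ i j, G.Adj (h i) (h j) ↔ H.Adj i j) ∨
      ∃ i j, i ≠ j ∧ ∃ A ⊆ S i, ∃ B ⊆ S j, #A = #B ∧ σ * u ≤ #B ∧
        (IsSparseTo G δ A B ∨ IsSparseTo Gᶜ δ A B) := by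
  induction k with
  | zero => exact ⟨1, one_pos, fun V G S u _ _ => .inl ⟨Fin.elim0, fun i => i.elim0,
      fun i => i.elim0⟩⟩
  | succ k ih =>
    obtain ⟨σ, hσ, ih⟩ := ih (H.comap Fin.succ)
    refine ⟨min (σ * (δ / (k + 1))) (1 / (k + 1)), by positivity, fun V G S u hu hS => ?_⟩
    by_cases hfew : ∀ v ∈ S 0, ∃ j : Fin k,
        (#(nbrs (if H.Adj 0 j.succ then G else Gᶜ) {v} (S j.succ)) : ℝ) ≤ δ / (k + 1) * u
    · obtain ⟨j, A, hA, B, hB, cardAB, cardB, sparse⟩ :=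
        exists_isSparseTo_of_forall_exists_card_nbrs_le hδ (hS 0) hu (fun j => hS j.succ) hfew
      refine .inr ⟨0, j.succ, (Fin.succ_ne_zero j).symm, A, hA, B, hB, cardAB, ?_, ?_⟩
      · calc _ ≤ 1 / (k + 1) * (u : ℝ) := by gcongr; exact min_le_right _ _
          _ ≤ #B := by rwa [one_div_mul_eq_div]
      · split_ifs at sparse
        · exact .inl sparse
        · exact .inr sparse
    push Not at hfew
    obtain ⟨v, hv, many⟩ := hfew
    have large := fun j => exists_subset_card_eq (Nat.ceil_le.2 (many j).le)
    choose T hT cardT using large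
    rcases ih V G T _ (Nat.ceil_pos.2 (by positivity)) cardT with
      ⟨h, hh, hadj⟩ | ⟨i, j, hij, A, hA, B, hB, cardAB, cardB, sparse⟩
    · exact .inl (exists_transversal_copy_cons hv (fun j => hT j (hh j)) hadj)
    · have hTS : ∀ j, T j ⊆ S j.succ := fun j => (hT j).trans nbrs_subset
      refine .inr ⟨i.succ, j.succ, Fin.succ_injective k |>.ne hij, A, hA.trans (hTS i), B,
        hB.trans (hTS j), cardAB, ?_, sparse⟩
      calc _ ≤ σ * (δ / (k + 1)) * (u : ℝ) := by gcongr; exact min_le_left _ _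
        _ = σ * (δ / (k + 1) * u) := by ring
        _ ≤ σ * ⌈δ / (k + 1) * (u : ℝ)⌉₊ := by gcongr; exact Nat.le_ceil _
        _ ≤ #B := cardB

theorem exists_pairwise_disjoint_subsets (X : Finset V) (hu : k * u ≤ #X) :
    ∃ S : Fin k → Finset V, (∀ i, S i ⊆ X ∧ #(S i) = u) ∧ Pairwise (Function.onFun Disjoint S) := by
  obtain ⟨f⟩ : Nonempty (Fin k × Fin u ↪ X) :=
    Function.Embedding.nonempty_of_card_le (by simpa using hu)
  let g (i : Fin k) : Fin u ↪ V :=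
    ⟨fun a => f (i, a), fun a b hab => by simpa using f.injective (Subtype.val_injective hab)⟩
  refine ⟨fun i => univ.map (g i), fun i => ⟨?_, by simp⟩, fun i j hij => ?_⟩
  · intro x hx
    obtain ⟨a, -, rfl⟩ := mem_map.1 hx
    exact (f (i, a)).2
  · refine Finset.disjoint_left.2 fun x hi hj => hij ?_
    obtain ⟨a, -, rfl⟩ := mem_map.1 hi
    obtain ⟨b, -, hb⟩ := mem_map.1 hj
    exact (Prod.mk.inj (f.injective (Subtype.val_injective hb))).1.symm

theorem le_two_mul_succ_mul_div {n : ℕ} (hk : 0 < k) (hkn : k ≤ n) :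
    n ≤ 2 * (k + 1) * (n / k) := by
  have := Nat.lt_mul_div_succ n hk
  have := Nat.le_mul_of_pos_right k (Nat.div_pos hkn hk)
  linarith [Nat.zero_le (n / k)]

theorem exists_disjoint_isSparseTo (hδ : 0 < δ) (H : SimpleGraph (Fin k)) :
    ∃ σ : ℝ, 0 < σ ∧ ∀ (V : Type u) (G : SimpleGraph V), ¬ H ⊴ G → ∀ X : Finset V, k ≤ #X →
      ∃ A ⊆ X, ∃ B ⊆ X, Disjoint A B ∧ #A = #B ∧ σ * #X ≤ #B ∧
        (IsSparseTo G δ A B ∨ IsSparseTo Gᶜ δ A B) := by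
  obtain ⟨σ, hσ, h⟩ := exists_transversal_copy_or_isSparseTo.{u} hδ H
  refine ⟨σ / (2 * (k + 1)), by positivity, fun V G hG X hX => ?_⟩
  rcases k.eq_zero_or_pos with rfl | hk
  · exact (hG ⟨⟨⟨Fin.elim0, fun i => i.elim0⟩, fun {i} => i.elim0⟩⟩).elim
  obtain ⟨S, hS, disj⟩ := exists_pairwise_disjoint_subsets X (Nat.mul_div_le #X k)
  rcases h V G S (#X / k) (Nat.div_pos hX hk) (fun i => (hS i).2) with
    ⟨h, hh, hadj⟩ | ⟨i, j, hij, A, hA, B, hB, cardAB, cardB, sparse⟩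
  · have inj : Function.Injective h := by
      intro i j heq
      by_contra hij
      exact Finset.disjoint_left.1 (disj hij) (hh i) (heq ▸ hh j)
    exact (hG ⟨⟨⟨h, inj⟩, fun {i j} => hadj i j⟩⟩).elim
  refine ⟨A, hA.trans (hS i).1, B, hB.trans (hS j).1, disjoint_of_subset_left hA
    (disjoint_of_subset_right hB (disj hij)), cardAB, le_trans ?_ cardB, sparse⟩
  have part : (#X : ℝ) ≤ 2 * (k + 1) * (#X / k : ℕ) := by
    exact_mod_cast le_two_mul_succ_mul_div hk hX
  calc σ / (2 * (k + 1)) * #X ≤ σ / (2 * (k + 1)) * (2 * (k + 1) * (#X / k : ℕ)) := by gcongr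
    _ = σ * (#X / k : ℕ) := by field_simp

/-- `U` behaves like the union of `s` disjoint sets of size `w ≤ #X` inside `X`, with at most
`ε * w ^ 2` edges between any two of them and no restriction inside each. -/
structure IsSparseUnion (G : SimpleGraph V) (ε : ℝ) (X : Finset V) (s w : ℕ) (U : Finset V) :
    Prop where
  subset : U ⊆ X
  card_eq : #U = s * w
  le_card : w ≤ #X
  card_interedges_le : (#(G.interedges U U) : ℝ) ≤ (s + ε * s ^ 2) * w ^ 2

theorem isSparseUnion_zero (G : SimpleGraph V) (ε : ℝ) (X : Finset V) :
    IsSparseUnion G ε X 0 #X ∅ :=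
  ⟨empty_subset X, by simp, le_rfl, by simp⟩

theorem IsSparseUnion.mono (h : IsSparseUnion G ε X s w U) (hX : X ⊆ Y) :
    IsSparseUnion G ε Y s w U :=
  ⟨h.subset.trans hX, h.card_eq, h.le_card.trans (card_le_card hX), h.card_interedges_le⟩

theorem card_interedges_union_self_le (G : SimpleGraph V) (U B : Finset V) :
    #(G.interedges (U ∪ B) (U ∪ B)) ≤
      #(G.interedges U U) + 2 * #(G.interedges U B) + #B ^ 2 := by
  have cover : G.interedges (U ∪ B) (U ∪ B) ⊆
      G.interedges U U ∪ G.interedges U B ∪ G.interedges B U ∪ G.interedges B B := by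
    intro e
    simp only [mem_union, mem_interedges_iff]
    tauto
  have := card_le_card cover
  have := card_union_le (G.interedges U U ∪ G.interedges U B ∪ G.interedges B U)
    (G.interedges B B)
  have := card_union_le (G.interedges U U ∪ G.interedges U B) (G.interedges B U)
  have := card_union_le (G.interedges U U) (G.interedges U B)
  have := G.symm
  have : #(G.interedges B U) = #(G.interedges U B) := Rel.card_interedges_comm B U
  have := G.card_interedges_le_mul B B
  rw [pow_two]
  omega

theorem IsSparseUnion.exists_succ (h : IsSparseUnion G ε A s w U) (hA : A ⊆ X) (hB : B ⊆ X)
    (disj : Disjoint A B) (cardAB : #A = #B) (hε : 0 ≤ ε)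
    (sparse : IsSparseTo G (ε * σ ^ 2 / 2) A B) (hσ : 0 ≤ σ) (hw : σ * #A ≤ w) :
    ∃ U, IsSparseUnion G ε X (s + 1) w U := by
  obtain ⟨B', hB', cardB'⟩ := exists_subset_card_eq (h.le_card.trans cardAB.le)
  have hUB' : Disjoint U B' :=
    disjoint_of_subset_left h.subset (disjoint_of_subset_right hB' disj)
  refine ⟨U ∪ B', union_subset (h.subset.trans hA) (hB'.trans hB), ?_,
    h.le_card.trans (card_le_card hA), ?_⟩
  · rw [card_union_of_disjoint hUB', h.card_eq, cardB', add_mul, one_mul]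
  have cross : 2 * (#(G.interedges U B') : ℝ) ≤ ε * w ^ 2 := by
    calc 2 * (#(G.interedges U B') : ℝ) ≤ 2 * #(G.interedges A B) := by
          exact_mod_cast Nat.mul_le_mul_left 2 (card_le_card (interedges_mono G h.subset hB'))
      _ ≤ 2 * (ε * σ ^ 2 / 2 * (#A * #B)) := by gcongr; exact sparse.card_interedges_le
      _ = ε * (σ * #A) ^ 2 := by rw [← cardAB]; ring
      _ ≤ ε * w ^ 2 := by gcongr
  calc (#(G.interedges (U ∪ B') (U ∪ B')) : ℝ)
      ≤ #(G.interedges U U) + 2 * #(G.interedges U B') + #B' ^ 2 := by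
        exact_mod_cast card_interedges_union_self_le G U B'
    _ ≤ (s + ε * s ^ 2) * w ^ 2 + ε * w ^ 2 + w ^ 2 := by
        rw [cardB']
        linarith [h.card_interedges_le]
    _ ≤ ((s + 1 : ℕ) + ε * (s + 1 : ℕ) ^ 2) * w ^ 2 := by
        push_cast
        nlinarith [show 0 ≤ ε * s * (w : ℝ) ^ 2 by positivity]

theorem exists_isSparseUnion (hε : 0 < ε) (H : SimpleGraph (Fin k)) (s t : ℕ) :
    ∃ σ : ℝ, 0 < σ ∧ ∃ N : ℕ, ∀ (V : Type u) (G : SimpleGraph V), ¬ H ⊴ G →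
      ∀ X : Finset V, N ≤ #X → ∃ w : ℕ, σ * #X ≤ w ∧
        ((∃ U, IsSparseUnion G ε X s w U) ∨ ∃ U, IsSparseUnion Gᶜ ε X t w U) := by
  induction s generalizing t with
  | zero =>
    exact ⟨1, one_pos, 0, fun V G _ X _ => ⟨#X, by simp, .inl ⟨∅, isSparseUnion_zero G ε X⟩⟩⟩
  | succ s ihs =>
    induction t with
    | zero =>
      exact ⟨1, one_pos, 0, fun V G _ X _ => ⟨#X, by simp, .inr ⟨∅, isSparseUnion_zero Gᶜ ε X⟩⟩⟩
    | succ t iht =>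
      obtain ⟨σ₁, hσ₁, N₁, h₁⟩ := ihs (t + 1)
      obtain ⟨σ₂, hσ₂, N₂, h₂⟩ := iht
      have hσ : 0 < min σ₁ σ₂ := lt_min hσ₁ hσ₂
      obtain ⟨σ₀, hσ₀, pair⟩ := exists_disjoint_isSparseTo.{u}
        (show 0 < ε * min σ₁ σ₂ ^ 2 / 2 by positivity) H
      refine ⟨min σ₁ σ₂ * σ₀, by positivity, max k ⌈(max N₁ N₂ : ℕ) / σ₀⌉₊, fun V G hG X hX => ?_⟩
      obtain ⟨A, hA, B, hB, disj, cardAB, cardB, sparse⟩ := pair V G hG X (le_of_max_le_left hX)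
      rw [← cardAB] at cardB
      have hN : max N₁ N₂ ≤ #A := by
        have := (div_le_iff₀' hσ₀).1 (Nat.ceil_le.1 (le_of_max_le_right hX))
        exact_mod_cast this.trans cardB
      have size {σ : ℝ} {w : ℕ} (hσ' : min σ₁ σ₂ ≤ σ) (hw : σ * #A ≤ w) :
          min σ₁ σ₂ * #A ≤ w ∧ min σ₁ σ₂ * σ₀ * #X ≤ w := by
        have small : min σ₁ σ₂ * #A ≤ w := le_trans (by gcongr) hw
        refine ⟨small, le_trans ?_ small⟩
        rw [mul_assoc]
        gcongr
      rcases sparse with sparse | sparse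
      · obtain ⟨w, hw, ⟨U, hU⟩ | ⟨U, hU⟩⟩ := h₁ V G hG A (le_of_max_le_left hN)
        all_goals obtain ⟨hwA, hwX⟩ := size (min_le_left _ _) hw
        · exact ⟨w, hwX, .inl (hU.exists_succ hA hB disj cardAB hε.le sparse hσ.le hwA)⟩
        · exact ⟨w, hwX, .inr ⟨U, hU.mono hA⟩⟩
      · obtain ⟨w, hw, ⟨U, hU⟩ | ⟨U, hU⟩⟩ := h₂ V G hG A (le_of_max_le_right hN)
        all_goals obtain ⟨hwA, hwX⟩ := size (min_le_right _ _) hw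
        · exact ⟨w, hwX, .inl ⟨U, hU.mono hA⟩⟩
        · exact ⟨w, hwX, .inr (hU.exists_succ hA hB disj cardAB hε.le sparse hσ.le hwA)⟩

theorem exists_isSparseTo_self_of_card_interedges_le (hδ : 0 < δ)
    (hU : (#(G.interedges U U) : ℝ) ≤ δ / 4 * #U ^ 2) :
    ∃ Y ⊆ U, #U ≤ 2 * #Y ∧ IsSparseTo G δ Y Y := by
  let Y : Finset V := {v ∈ U | (#(nbrs G {v} U) : ℝ) ≤ δ / 2 * #U}
  let Z : Finset V := {v ∈ U | ¬ (#(nbrs G {v} U) : ℝ) ≤ δ / 2 * #U}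
  have split : #Y + #Z = #U := card_filter_add_card_filter_not _
  have markov : #Z * (δ / 2 * #U) ≤ δ / 4 * #U ^ 2 := by
    calc #Z * (δ / 2 * #U) = #Z • (δ / 2 * #U) := (nsmul_eq_mul _ _).symm
      _ ≤ ∑ v ∈ Z, (#(nbrs G {v} U) : ℝ) :=
        card_nsmul_le_sum _ _ _ fun v hv => (not_le.1 (mem_filter.1 hv).2).le
      _ ≤ ∑ v ∈ U, (#(nbrs G {v} U) : ℝ) :=
        sum_le_sum_of_subset_of_nonneg (filter_subset _ _) fun _ _ _ => Nat.cast_nonneg _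
      _ = #(G.interedges U U) := by rw [card_interedges_eq_sum_card_nbrs, Nat.cast_sum]
      _ ≤ δ / 4 * #U ^ 2 := hU
  have half : #U ≤ 2 * #Y := by
    rcases (#U).eq_zero_or_pos with hU0 | hU0
    · omega
    have hU0' : (0 : ℝ) < #U := by exact_mod_cast hU0
    have : (2 * #Z : ℝ) ≤ #U := le_of_mul_le_mul_left
      (show δ / 4 * #U * (2 * #Z) ≤ δ / 4 * #U * #U by linarith) (by positivity)
    have : 2 * #Z ≤ #U := by exact_mod_cast this
    omega
  refine ⟨Y, filter_subset _ _, half, fun v hv => ?_⟩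
  calc (#(nbrs G {v} Y) : ℝ) ≤ #(nbrs G {v} U) := by
        exact_mod_cast card_le_card (nbrs_mono subset_rfl (filter_subset _ _))
    _ ≤ δ / 2 * #U := (mem_filter.1 hv).2
    _ ≤ δ / 2 * (2 * #Y) := by gcongr; exact_mod_cast half
    _ = δ * #Y := by ring

theorem IsSparseUnion.exists_isSparseTo_self (h : IsSparseUnion G (δ / 8) X s w U) (hδ : 0 < δ)
    (hs : 8 ≤ δ * s) : ∃ Y ⊆ X, w ≤ 2 * #Y ∧ IsSparseTo G δ Y Y := by
  have few : (#(G.interedges U U) : ℝ) ≤ δ / 4 * #U ^ 2 := by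
    calc (#(G.interedges U U) : ℝ) ≤ (s + δ / 8 * s ^ 2) * w ^ 2 := h.card_interedges_le
      _ ≤ (δ * s / 8 * s + δ / 8 * s ^ 2) * w ^ 2 := by
        gcongr
        exact le_mul_of_one_le_left (by positivity) (by linarith)
      _ = δ / 4 * #U ^ 2 := by rw [h.card_eq, Nat.cast_mul]; ring
  obtain ⟨Y, hY, half, sparse⟩ := exists_isSparseTo_self_of_card_interedges_le hδ few
  have s_pos : 0 < s := by
    by_contra! hs0
    norm_num [Nat.le_zero.1 hs0] at hs
  have := Nat.le_mul_of_pos_left w s_pos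
  exact ⟨Y, hY.trans h.subset, by rw [h.card_eq] at half; omega, sparse⟩

theorem isSparseTo_singleton_self (hδ : 0 ≤ δ) (x : V) : IsSparseTo G δ {x} {x} := by
  intro a ha
  rw [mem_singleton.1 ha, card_eq_zero.2]
  · simpa using hδ
  · simp [nbrs]

theorem exists_isSparseTo_self_or_compl (hδ : 0 < δ) (H : SimpleGraph (Fin k)) :
    ∃ σ : ℝ, 0 < σ ∧ σ ≤ 1 ∧ ∀ (V : Type u) (G : SimpleGraph V), ¬ H ⊴ G → ∀ X : Finset V,
      ∃ Y ⊆ X, σ * #X ≤ #Y ∧ (IsSparseTo G δ Y Y ∨ IsSparseTo Gᶜ δ Y Y) := by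
  obtain ⟨s, hs⟩ := exists_nat_ge (8 / δ)
  rw [div_le_iff₀' hδ] at hs
  obtain ⟨σ, hσ, N, h⟩ := exists_isSparseUnion.{u} (show 0 < δ / 8 by positivity) H s s
  have σ_le_one : min (σ / 2) (1 / (N + 1)) ≤ 1 :=
    (min_le_right _ _).trans (div_le_one_of_le₀ (by simp) (by positivity))
  refine ⟨min (σ / 2) (1 / (N + 1)), by positivity, σ_le_one, fun V G hG X => ?_⟩
  rcases X.eq_empty_or_nonempty with rfl | ⟨x, hx⟩
  · exact ⟨∅, subset_rfl, by simp, .inl fun a ha => by simp at ha⟩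
  by_cases hX : N ≤ #X
  · obtain ⟨w, hw, ⟨U, hU⟩ | ⟨U, hU⟩⟩ := h V G hG X hX
    all_goals
      obtain ⟨Y, hY, half, sparse⟩ := hU.exists_isSparseTo_self hδ hs
      refine ⟨Y, hY, ?_, by tauto⟩
      calc _ ≤ σ / 2 * (#X : ℝ) := by gcongr; exact min_le_left _ _
        _ = σ * #X / 2 := by ring
        _ ≤ w / 2 := by gcongr
        _ ≤ #Y := by
          rw [div_le_iff₀' two_pos]
          exact_mod_cast half
  · refine ⟨{x}, singleton_subset_iff.2 hx, ?_, .inl (isSparseTo_singleton_self hδ.le x)⟩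
    have : (#X : ℝ) ≤ N := by exact_mod_cast (not_le.1 hX).le
    calc _ ≤ 1 / (N + 1) * (#X : ℝ) := by gcongr; exact min_le_right _ _
      _ ≤ #{x} := by
        rw [one_div_mul_eq_div, card_singleton, Nat.cast_one, div_le_one₀ (by positivity)]
        linarith

end Roedl

section AnticompletePairs

variable {V W : Type u} {G : SimpleGraph V} {Y : Finset V} {a a' b b' c δ : ℝ} {q : ℕ}

/-- `G` has an anticomplete pair of sets of sizes at least `a` and `b`. -/
def HasAnticompletePair (G : SimpleGraph V) (a b : ℝ) : Prop :=
  ∃ A B : Finset V, Disjoint A B ∧ G.IsAnticompleteBetween (A : Set V) (B : Set V) ∧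
    a ≤ #A ∧ b ≤ #B

theorem HasAnticompletePair.mono (h : HasAnticompletePair G a b) (ha : a' ≤ a) (hb : b' ≤ b) :
    HasAnticompletePair G a' b' := by
  obtain ⟨A, B, disj, anti, hA, hB⟩ := h
  exact ⟨A, B, disj, anti, ha.trans hA, hb.trans hB⟩

theorem HasAnticompletePair.of_comap {f : W ↪ V} (h : HasAnticompletePair (G.comap f) a b) :
    HasAnticompletePair G a b := by
  obtain ⟨A, B, disj, anti, hA, hB⟩ := h
  refine ⟨A.map f, B.map f, (disjoint_map f).2 disj, ?_, by rwa [card_map], by rwa [card_map]⟩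
  simp only [coe_map, IsAnticompleteBetween, Set.forall_mem_image]
  exact anti

theorem HasAnticompletePair.exists_isPurePair (h : HasAnticompletePair G a b) :
    ∃ A B : Finset V, G.IsPurePair A B ∧ a ≤ #A ∧ b ≤ #B := by
  obtain ⟨A, B, disj, anti, hA, hB⟩ := h
  exact ⟨A, B, ⟨disj, .inr anti⟩, hA, hB⟩

theorem HasAnticompletePair.exists_isPurePair_of_compl (h : HasAnticompletePair Gᶜ a b) :
    ∃ A B : Finset V, G.IsPurePair A B ∧ a ≤ #A ∧ b ≤ #B := by
  obtain ⟨A, B, disj, anti, hA, hB⟩ := h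
  refine ⟨A, B, ⟨disj, .inl fun x hx y hy => ?_⟩, hA, hB⟩
  by_contra hxy
  exact anti hx hy ((compl_adj G x y).2 ⟨disjoint_iff_ne.1 disj x hx y hy, hxy⟩)

theorem exists_isPurePair_singleton [Nontrivial V] (G : SimpleGraph V) :
    ∃ A B : Finset V, G.IsPurePair A B ∧ #A = 1 ∧ #B = 1 := by
  obtain ⟨x, y, hxy⟩ := exists_pair_ne V
  refine ⟨{x}, {y}, ⟨disjoint_singleton.2 hxy, ?_⟩, card_singleton x, card_singleton y⟩
  by_cases hadj : G.Adj x y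
  · exact .inl (by simpa [IsCompleteBetween] using hadj)
  · exact .inr (by simpa [IsAnticompleteBetween] using hadj)

theorem OddHoleFree.comap (hG : OddHoleFree G) (f : W ↪ V) : OddHoleFree (G.comap f) :=
  fun k hk hole => hG k hk (hole.trans ⟨Embedding.comap f G⟩)

theorem IsSparseTo.comap_subtype (h : IsSparseTo G δ Y Y) :
    IsSparseTo (G.comap (Function.Embedding.subtype (· ∈ Y))) δ univ univ := by
  intro v _
  have sub : (nbrs (G.comap (Function.Embedding.subtype (· ∈ Y))) {v} univ).map
      (Function.Embedding.subtype (· ∈ Y)) ⊆ nbrs G {↑v} Y := by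
    intro x hx
    obtain ⟨y, hy, rfl⟩ := mem_map.1 hx
    exact mem_nbrs.2 ⟨y.2, v, mem_singleton_self _, by simpa using (mem_nbrs.1 hy).2⟩
  have := card_le_card sub
  rw [card_map] at this
  rw [card_univ, Fintype.card_coe]
  exact le_trans (by exact_mod_cast this) (h v v.2)

theorem isCoherent_of_not_hasAnticompletePair [Fintype V] {d m : ℕ}
    (sparse : IsSparseTo G δ univ univ) (hd : δ * Fintype.card V ≤ d)
    (h : ¬ HasAnticompletePair G d m) (hm : 1 ≤ m) (hmd : m ≤ d) : IsCoherent G d m where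
  card_nbrs_singleton v S := by
    have degree : (#(nbrs G {v} univ) : ℝ) ≤ d := (sparse v (mem_univ v)).trans hd
    exact (card_le_card (nbrs_mono subset_rfl (subset_univ S))).trans (by exact_mod_cast degree)
  exists_adj A B disj hA hB := by
    by_contra! anti
    exact h ⟨A, B, disj, anti, by exact_mod_cast hA, by exact_mod_cast hB⟩
  one_le := hm
  le := hmd

theorem eventually_le_natCast_rpow {y : ℝ} (hy : 0 < y) (C : ℝ) :
    ∀ᶠ n : ℕ in Filter.atTop, C ≤ (n : ℝ) ^ y :=
  ((tendsto_rpow_atTop hy).comp tendsto_natCast_atTop_atTop).eventually_ge_atTop C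

theorem eventually_lt_floor_rpow_pow (hc : 0 < c) (hq : 8 ≤ c * q) :
    ∀ᶠ n : ℕ in Filter.atTop, n < ⌊(n : ℝ) ^ (c / 2)⌋₊ ^ q := by
  filter_upwards [eventually_le_natCast_rpow (show 0 < c / 4 by positivity) 2,
    Filter.eventually_gt_atTop 1] with n hn hn1
  have root : (n : ℝ) ^ (c / 4) ≤ ⌊(n : ℝ) ^ (c / 2)⌋₊ := by
    have square : (n : ℝ) ^ (c / 2) = (n : ℝ) ^ (c / 4) * (n : ℝ) ^ (c / 4) := by
      rw [← Real.rpow_add (by positivity)]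
      ring_nf
    have := Nat.lt_floor_add_one ((n : ℝ) ^ (c / 2))
    nlinarith
  have : (n : ℝ) < (⌊(n : ℝ) ^ (c / 2)⌋₊ : ℝ) ^ q := by
    calc (n : ℝ) = (n : ℝ) ^ (1 : ℝ) := (Real.rpow_one _).symm
      _ < (n : ℝ) ^ (c / 4 * q) :=
        Real.rpow_lt_rpow_of_exponent_lt (by exact_mod_cast hn1) (by linarith)
      _ = ((n : ℝ) ^ (c / 4)) ^ q := Real.rpow_mul_natCast n.cast_nonneg _ _
      _ ≤ (⌊(n : ℝ) ^ (c / 2)⌋₊ : ℝ) ^ q := by gcongr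
  exact_mod_cast this

theorem eventually_two_mul_floor_mul_ceil_le (hc : 0 < c) (hc1 : c < 1) (hδ : 0 < δ) :
    ∀ᶠ n : ℕ in Filter.atTop,
      2 * ⌊(n : ℝ) ^ (c / 2)⌋₊ * ⌈δ * (n : ℝ) ^ (1 - c)⌉₊ ≤ ⌈δ * n⌉₊ := by
  filter_upwards [eventually_le_natCast_rpow (half_pos hc) 4,
    eventually_le_natCast_rpow (sub_pos.2 hc1) (1 / δ), Filter.eventually_gt_atTop 0]
    with n hn hn' hn0
  have one_le : 1 ≤ δ * (n : ℝ) ^ (1 - c) := (div_le_iff₀' hδ).1 hn'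
  have ceil_le : (⌈δ * (n : ℝ) ^ (1 - c)⌉₊ : ℝ) ≤ 2 * (δ * (n : ℝ) ^ (1 - c)) := by
    have := Nat.ceil_lt_add_one (zero_le_one.trans one_le)
    linarith
  have floor_le : (⌊(n : ℝ) ^ (c / 2)⌋₊ : ℝ) ≤ (n : ℝ) ^ (c / 2) := Nat.floor_le (by positivity)
  have factor : (n : ℝ) ^ (c / 2) * (n : ℝ) ^ (c / 2) * (n : ℝ) ^ (1 - c) = n := by
    rw [← Real.rpow_add (by positivity), ← Real.rpow_add (by positivity)]
    ring_nf
    exact Real.rpow_one _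
  have : (2 * ⌊(n : ℝ) ^ (c / 2)⌋₊ * ⌈δ * (n : ℝ) ^ (1 - c)⌉₊ : ℝ) ≤ ⌈δ * n⌉₊ := by
    calc (2 * ⌊(n : ℝ) ^ (c / 2)⌋₊ * ⌈δ * (n : ℝ) ^ (1 - c)⌉₊ : ℝ)
        ≤ 2 * (n : ℝ) ^ (c / 2) * (2 * (δ * (n : ℝ) ^ (1 - c))) := by gcongr
      _ = 4 * (n : ℝ) ^ (c / 2) * (δ * (n : ℝ) ^ (1 - c)) := by ring
      _ ≤ (n : ℝ) ^ (c / 2) * (n : ℝ) ^ (c / 2) * (δ * (n : ℝ) ^ (1 - c)) := by gcongr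
      _ = δ * ((n : ℝ) ^ (c / 2) * (n : ℝ) ^ (c / 2) * (n : ℝ) ^ (1 - c)) := by ring
      _ = δ * n := by rw [factor]
      _ ≤ ⌈δ * n⌉₊ := Nat.le_ceil _
  exact_mod_cast this

theorem mul_ceil_lt {K n : ℕ} (hn : 1 ≤ 1 / (2 * (K + 1) : ℝ) * n) :
    K * ⌈1 / (2 * (K + 1) : ℝ) * n⌉₊ < n := by
  have ceil_lt := Nat.ceil_lt_add_one (zero_le_one.trans hn)
  have : (K + 1) * (⌈1 / (2 * (K + 1) : ℝ) * n⌉₊ : ℝ) ≤ n := by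
    calc (K + 1) * (⌈1 / (2 * (K + 1) : ℝ) * n⌉₊ : ℝ)
        ≤ (K + 1) * (2 * (1 / (2 * (K + 1)) * n)) := by gcongr; linarith
      _ = n := by field_simp
  have : (K + 1) * ⌈1 / (2 * (K + 1) : ℝ) * n⌉₊ ≤ n := by exact_mod_cast this
  have : 0 < ⌈1 / (2 * (K + 1) : ℝ) * n⌉₊ := Nat.ceil_pos.2 (zero_lt_one.trans_le hn)
  linarith

theorem exists_hasAnticompletePair_of_isSparseTo_univ (hc : 0 < c) (hc1 : c < 1) :
    ∃ δ : ℝ, 0 < δ ∧ ∃ N : ℕ, ∀ (V : Type u) [Fintype V] (G : SimpleGraph V),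
      OddHoleFree G → N ≤ Fintype.card V → IsSparseTo G δ univ univ →
      HasAnticompletePair G (δ * Fintype.card V) (δ * (Fintype.card V : ℝ) ^ (1 - c)) := by
  obtain ⟨q, hq⟩ := exists_nat_ge (8 / c)
  rw [div_le_iff₀' hc] at hq
  let δ : ℝ := 1 / (2 * (stabilityBound q + 1))
  have hδ : 0 < δ := by positivity
  obtain ⟨N, hN⟩ := Filter.eventually_atTop.1 <| (eventually_lt_floor_rpow_pow hc hq).and <|
    (eventually_two_mul_floor_mul_ceil_le hc hc1 hδ).and <|
    (eventually_le_natCast_rpow (sub_pos.2 hc1) (1 / δ)).and <|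
    (eventually_le_natCast_rpow (half_pos hc) 1).and (Filter.eventually_ge_atTop 1)
  refine ⟨δ, hδ, N, fun V _ G hG hV sparse => ?_⟩
  obtain ⟨lt_pow, htm, hn, ht, hn1⟩ := hN _ hV
  have hn1 : (1 : ℝ) ≤ Fintype.card V := by exact_mod_cast hn1
  have one_le : 1 ≤ δ * (Fintype.card V : ℝ) ^ (1 - c) := (div_le_iff₀' hδ).1 hn
  have rpow_le : δ * (Fintype.card V : ℝ) ^ (1 - c) ≤ δ * Fintype.card V := by
    gcongr
    exact Real.rpow_le_self_of_one_le hn1 (by linarith)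
  by_contra none
  have coherent : IsCoherent G ⌈δ * Fintype.card V⌉₊ ⌈δ * (Fintype.card V : ℝ) ^ (1 - c)⌉₊ :=
    isCoherent_of_not_hasAnticompletePair sparse (Nat.le_ceil _)
      (fun h => none (h.mono (Nat.le_ceil _) (Nat.le_ceil _)))
      (Nat.ceil_pos.2 (zero_lt_one.trans_le one_le)) (Nat.ceil_le_ceil rpow_le)
  have card_le := coherent.card_le_stabilityBound_mul (S := univ) hG
    ((Nat.one_le_floor_iff _).2 ht) htm (by rwa [card_univ])
  exact (mul_ceil_lt (one_le.trans rpow_le)).not_ge (card_univ (α := V) ▸ card_le)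

theorem exists_hasAnticompletePair_of_isSparseTo_self (hc : 0 < c) (hc1 : c < 1) :
    ∃ δ : ℝ, 0 < δ ∧ ∃ N : ℕ, ∀ (V : Type u) (G : SimpleGraph V), OddHoleFree G →
      ∀ Y : Finset V, N ≤ #Y → IsSparseTo G δ Y Y →
      HasAnticompletePair G (δ * #Y) (δ * (#Y : ℝ) ^ (1 - c)) := by
  obtain ⟨δ, hδ, N, h⟩ := exists_hasAnticompletePair_of_isSparseTo_univ.{u} hc hc1
  refine ⟨δ, hδ, N, fun V G hG Y hY sparse => ?_⟩
  have := h Y _ (hG.comap (.subtype (· ∈ Y))) (by rwa [Fintype.card_coe]) sparse.comap_subtype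
  rw [Fintype.card_coe] at this
  exact this.of_comap

theorem mul_rpow_le_rpow {σ n y : ℝ} (hc : 0 ≤ c) (hc1 : c ≤ 1) (hσ : 0 < σ) (hσ1 : σ ≤ 1)
    (hn : 0 ≤ n) (hy : σ * n ≤ y) : σ * n ^ (1 - c) ≤ y ^ (1 - c) := by
  calc σ * n ^ (1 - c) ≤ σ ^ (1 - c) * n ^ (1 - c) := by
        gcongr
        exact Real.self_le_rpow_of_le_one hσ.le hσ1 (by linarith)
    _ = (σ * n) ^ (1 - c) := (Real.mul_rpow hσ.le hn).symm
    _ ≤ y ^ (1 - c) := by gcongr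

theorem exists_hasAnticompletePair_or_compl_of_isBerge (hc : 0 < c) (hc1 : c < 1) :
    ∃ ε : ℝ, 0 < ε ∧ ∃ N : ℕ, ∀ (V : Type u) [Fintype V] (G : SimpleGraph V), IsBerge G →
      N ≤ Fintype.card V →
      HasAnticompletePair G (ε * Fintype.card V) (ε * (Fintype.card V : ℝ) ^ (1 - c)) ∨
      HasAnticompletePair Gᶜ (ε * Fintype.card V) (ε * (Fintype.card V : ℝ) ^ (1 - c)) := by
  obtain ⟨δ, hδ, N, pair⟩ := exists_hasAnticompletePair_of_isSparseTo_self.{u} hc hc1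
  obtain ⟨σ, hσ, hσ1, roedl⟩ := exists_isSparseTo_self_or_compl.{u} hδ (cycleGraph 5)
  refine ⟨δ * σ, by positivity, ⌈N / σ⌉₊, fun V _ G hG hV => ?_⟩
  obtain ⟨Y, -, hY, sparse⟩ := roedl V G (hG.1 2 le_rfl) univ
  rw [card_univ] at hY
  have hN : N ≤ #Y := by
    exact_mod_cast ((div_le_iff₀' hσ).1 (Nat.ceil_le.1 hV)).trans hY
  have enlarge {F : SimpleGraph V} (h : HasAnticompletePair F (δ * #Y) (δ * (#Y : ℝ) ^ (1 - c))) :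
      HasAnticompletePair F (δ * σ * Fintype.card V)
        (δ * σ * (Fintype.card V : ℝ) ^ (1 - c)) := by
    refine h.mono ?_ ?_ <;> rw [mul_assoc]
    · gcongr
    · gcongr
      exact mul_rpow_le_rpow hc.le hc1.le hσ hσ1 (by positivity) hY
  exact sparse.imp (fun h => enlarge (pair V G hG.1 Y hN h))
    fun h => enlarge (pair V Gᶜ hG.2 Y hN h)

end AnticompletePairs

theorem _root_.mainTheorem4_general (c : ℝ) (hc : 0 < c) :
    ∃ ε : ℝ, 0 < ε ∧
      ∀ (V : Type u) [Fintype V] (G : SimpleGraph V),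
        IsBerge G → 1 < Fintype.card V →
          ∃ A B : Finset V, G.IsPurePair A B ∧
            ε * (Fintype.card V : ℝ) ≤ (A.card : ℝ) ∧
            ε * (Fintype.card V : ℝ) ^ (1 - c) ≤ (B.card : ℝ) := by
  obtain ⟨ε, hε, N, h⟩ := exists_hasAnticompletePair_or_compl_of_isBerge.{u}
    (show 0 < min c (1 / 2) by positivity) (min_lt_of_right_lt one_half_lt_one)
  refine ⟨min ε (1 / (N + 1)), by positivity, fun V _ G hG hV => ?_⟩
  have hn : (1 : ℝ) ≤ Fintype.card V := by exact_mod_cast hV.le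
  by_cases hN : N ≤ Fintype.card V
  · have enlarge {F : SimpleGraph V} (hF : HasAnticompletePair F (ε * Fintype.card V)
        (ε * (Fintype.card V : ℝ) ^ (1 - min c (1 / 2)))) :=
      hF.mono (a' := min ε (1 / (N + 1)) * Fintype.card V)
        (b' := min ε (1 / (N + 1)) * (Fintype.card V : ℝ) ^ (1 - c))
        (by gcongr; exact min_le_left _ _) (by gcongr <;> exact min_le_left _ _)
    exact (h V G hG hN).elim (fun h => (enlarge h).exists_isPurePair)
      fun h => (enlarge h).exists_isPurePair_of_compl
  · have := Fintype.one_lt_card_iff_nontrivial.1 hV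
    obtain ⟨A, B, pure, hA, hB⟩ := exists_isPurePair_singleton G
    have small : min ε (1 / (N + 1)) * (Fintype.card V : ℝ) ≤ 1 := by
      have : (Fintype.card V : ℝ) ≤ N := by exact_mod_cast (not_le.1 hN).le
      calc _ ≤ 1 / (N + 1) * (Fintype.card V : ℝ) := by gcongr; exact min_le_right _ _
        _ ≤ 1 := by rw [one_div_mul_eq_div, div_le_one₀ (by positivity)]; linarith
    refine ⟨A, B, pure, by rwa [hA, Nat.cast_one], ?_⟩
    rw [hB, Nat.cast_one]
    refine le_trans ?_ small
    gcongr
    exact Real.rpow_le_self_of_one_le hn (by linarith)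

end PurePairs

theorem mainTheorem4 (c : ℝ) (hc : 0 < c) :
    ∃ ε : ℝ, 0 < ε ∧
      ∀ (V : Type u) [Fintype V] (G : SimpleGraph V),
        G.IsPerfect → 1 < Fintype.card V →
          ∃ A B : Finset V, G.IsPurePair A B ∧
            ε * (Fintype.card V : ℝ) ≤ (A.card : ℝ) ∧
            ε * (Fintype.card V : ℝ) ^ (1 - c) ≤ (B.card : ℝ) := by
  obtain ⟨ε, hε, h⟩ := mainTheorem4_general.{u} c hc
  exact ⟨ε, hε, fun V _ G hG => h V G (PurePairs.isBerge_of_isPerfect hG)⟩
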